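/- Let $k\ge 2$ and let $X^*$ be the free monoid on $X=\{x_0,x_1,x_2,\dots\}$. **Forests.** A *linearized $k$-ary forest* is a sequence (indexed by the root labels $0,1,2,\dots$) of planar rooted trees in which every interior vertex has exactly $k$ children, only finitely many trees are non-trivial, and the interior vertices are labeled bijectively by $1,\dots,n$ (for some $n$) so that labels decrease along every path from a root to a leaf. The forest $\tau(u)$ of the word $u=x_{i_1}\cdots x_{i_n}$ is obtained from the trivial forest by adding, in step $j=1,\dots,n$, an interior vertex labeled $j$ whose children are the current roots $i_j,i_j+1,\dots,i_j+k-1$; the new root gets the number $i_j$ and the roots to the right of it are renumbered consecutively. *De-linearization* deletes all labels of interior vertices. Write $u\sim v$ if the de-linearizations of $\tau(u)$ and $\tau(v)$ are equal. **$*$-sequences.** A *$*$-sequence* is an infinite sequence $\sigma(1),\sigma(2),\dots$ in which, for some $n$, each of $1,\dots,n$ occurs exactly $k-1$ times, all other terms are $*$, and no term between two occurrences of a concrete symbol $j\in\{1,\dots,n\}$ is larger than $j$; here $*$ is larger than every concrete symbol. The $*$-sequence $\pi(u)$ of the word $u=x_{i_1}\cdots x_{i_n}$ is obtained from an infinite row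 of open slots by placing, in step $j=1,\dots,n$, $k-1$ copies of $j$ in consecutive open slots after leaving the $i_j$ leftmost open slots open; the slots that remain open are filled with $*$. Order $*$-sequences by the reflexive and transitive closure of the following steps up: if all occurrences of $i$ are to the left of all occurrences of $i+1$ (both concrete), exchange all occurrences of $i$ with all occurrences of $i+1$. (For $k=2$ this is the left weak Bruhat order.) A $*$-sequence $\sigma$ is *$132$-avoiding* if there are no $a<b<c$ with $\sigma(a)<\sigma(c)<\sigma(b)$, and *$231$-avoiding* if there are no $a<b<c$ with $\sigma(c)<\sigma(a)<\sigma(b)$. **Polygon partitions.** Place a sequence of polygons along the points $0,1,2,\dots$: each polygon has consecutive integers $a,a+1,\dots,b$ as vertices, the next polygon begins at $b$, and all but finitely many polygons are $2$-gons $\{a,a+1\}$, regarded as single edges. A partition of the sequence into $(k+1)$-gons is given by its set of sides and non-crossing diagonals. For a $*$-sequence $\sigma$ with concrete symbols $1,\dots,n$, let the partition $Q(\sigma)$ be the union, over $i=n,n-1,\dots,0$, of the paths that connect, in increasing order, the vertex $0$ and all vertices $v\ge 1$ with $\sigma(v)>i$. Then: 1. $\tau$ is a bijection from $X^*$ onto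 the set of linearized $k$-ary forests, $\pi$ is a bijection from $X^*$ onto the set of $*$-sequences, and the sets $Q(\pi(u))$, $u\in X^*$, are exactly the partitions of such sequences of polygons into $(k+1)$-gons. 2. For all $u,v\in X^*$: $u\sim v$ if and only if $Q(\pi(u))=Q(\pi(v))$. 3. $\sim$ is a monoid congruence on $X^*$, and $X^*/{\sim}$ is the Thompson monoid $$P_k=\mathrm{Mon}\langle x_0,x_1,x_2,\dots \mid x_ix_j=x_{j+k-1}x_i \text{ for } i<j\rangle,$$ by an isomorphism that sends the class of $x_i$ to the generator $x_i$ for every $i$. 4. For every $\sim$-class of words, the set of the corresponding $*$-sequences $\pi(u)$ has a top (greatest) element and a bottom (least) element; the top element is $132$-avoiding and the bottom element is $231$-avoiding. -/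

import Mathlib

namespace PolygonTamari

/-! ### The monoid `P_k` -/

/-- The defining relations `x_i x_j = x_{j+k-1} x_i`, `i < j`. -/
inductive ThompsonRel (k : ℕ) : FreeMonoid ℕ → FreeMonoid ℕ → Prop
  | swap (i j : ℕ) (h : i < j) :
      ThompsonRel k (FreeMonoid.of i * FreeMonoid.of j)
        (FreeMonoid.of (j + (k - 1)) * FreeMonoid.of i)

/-- The monoid `P_k = Mon ⟨x_0, x_1, … | x_i x_j = x_{j+k-1} x_i, i < j⟩`. -/
abbrev ThompsonMonoid (k : ℕ) : Type := PresentedMonoid (ThompsonRel k)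

/-! ### Linearized `k`-ary forests -/

/-- Planar rooted `k`-ary trees with interior vertices (carets) labeled by elements of `α`. -/
inductive KTree (k : ℕ) (α : Type) : Type
  | leaf : KTree k α
  | node (label : α) (children : Fin k → KTree k α) : KTree k α

/-- Relabeling of the interior vertices. -/
def KTree.map {k : ℕ} {α β : Type} (g : α → β) : KTree k α → KTree k β
  | .leaf => .leaf
  | .node l c => .node (g l) (fun i => (c i).map g)

/-- The number of interior vertices with label `j`. -/
def KTree.count {k : ℕ} (j : ℕ) : KTree k ℕ → ℕ
  | .leaf => 0
  | .node l c => (if l = j then 1 else 0) + ∑ i, (c i).count j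

/-- The root, if it is an interior vertex, has label smaller than `l`. -/
def KTree.RootBelow {k : ℕ} (l : ℕ) : KTree k ℕ → Prop
  | .leaf => True
  | .node l' _ => l' < l

/-- The labels decrease on every path from the root to a leaf. -/
def KTree.Decreasing {k : ℕ} : KTree k ℕ → Prop
  | .leaf => True
  | .node l c => ∀ i, (c i).RootBelow l ∧ (c i).Decreasing

/-- A sequence of planar `k`-ary trees; the tree number `i` is the one whose root has root label
`i`. The leaves are numbered by `0, 1, 2, …` from left to right. -/
abbrev Forest (k : ℕ) (α : Type) : Type := ℕ → KTree k α

/-- Linearized forests: only finitely many trees are non-trivial, the interior vertices are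
labeled bijectively by `1, …, n` for some `n`, and labels decrease from the roots to the leaves. -/
def IsLinearizedForest (k : ℕ) (f : Forest k ℕ) : Prop :=
  {i | f i ≠ .leaf}.Finite ∧ (∀ i, (f i).Decreasing) ∧
    ∃ n : ℕ, ∀ j, ∑ᶠ i, (f i).count j = if 1 ≤ j ∧ j ≤ n then 1 else 0

/-- Add a new `k`-caret with label `l` that joins the roots `i, i + 1, …, i + k - 1`; the new
root gets number `i`, and the roots further to the right are renumbered. -/
def addCaret {k : ℕ} {α : Type} (l : α) (i : ℕ) (f : Forest k α) : Forest k α := fun m =>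
  if m < i then f m
  else if m = i then .node l (fun c => f (i + c))
  else f (m + (k - 1))

/-- Add carets labeled `j, j + 1, j + 2, …` at the successive root numbers in the list. -/
def addCarets {k : ℕ} : ℕ → List ℕ → Forest k ℕ → Forest k ℕ
  | _, [], f => f
  | j, i :: w, f => addCarets (j + 1) w (addCaret j i f)

/-- The linearized forest of the word `x_{i_1} … x_{i_n}`: starting from the trivial forest, in
step `j` a caret labeled `j` is added at root `i_j`. -/
def linearizedForest (k : ℕ) (u : FreeMonoid ℕ) : Forest k ℕ :=
  addCarets 1 u.toList (fun _ => .leaf)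

/-- De-linearization: the labels of the interior vertices are deleted. -/
def delinearize {k : ℕ} (f : Forest k ℕ) : Forest k Unit := fun i => (f i).map (fun _ => ())

/-- Two words are equivalent if their forests agree after de-linearization. -/
def TamariEquiv (k : ℕ) (u v : FreeMonoid ℕ) : Prop :=
  delinearize (linearizedForest k u) = delinearize (linearizedForest k v)

/-! ### `*`-sequences

A sequence is a function `σ : ℕ → ℕ∞`; the value `⊤` is the symbol `*`, which is larger than all
concrete symbols. The term at index `p` belongs to the gap between the leaves `p` and `p + 1`. -/

/-- For some `n`, each of `1, …, n` occurs exactly `k - 1` times, all other terms are `*`, and no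
term between two occurrences of a concrete symbol is larger than this symbol. -/
def IsStarSequence (k : ℕ) (σ : ℕ → ℕ∞) : Prop :=
  (∃ n : ℕ, (∀ p, σ p = ⊤ ∨ ∃ j : ℕ, 1 ≤ j ∧ j ≤ n ∧ σ p = j) ∧
      ∀ j : ℕ, 1 ≤ j → j ≤ n → {p | σ p = j}.ncard = k - 1) ∧
    ∀ a b c, a < b → b < c → σ a = σ c → σ a ≠ ⊤ → σ b ≤ σ a

/-- The slot-filling procedure for a word: in step `j`, leave the `i_j` leftmost open slots open
and put `k - 1` copies of `j` into the next open slots; slots that stay open are filled with `*`.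
The first letter `i` takes the slots `i, …, i + (k - 1) - 1`; the remaining word is then treated in
the same way in the remaining slots, with its symbols increased by one (and `⊤ + 1 = ⊤`). -/
def fillSlots (k : ℕ) : List ℕ → ℕ → ℕ∞
  | [], _ => ⊤
  | i :: w, p =>
    if p < i then fillSlots k w p + 1
    else if p < i + (k - 1) then 1
    else fillSlots k w (p - (k - 1)) + 1

/-- The `*`-sequence of a word. -/
def starSequence (k : ℕ) (u : FreeMonoid ℕ) : ℕ → ℕ∞ := fillSlots k u.toList

/-- One step up: all occurrences of `i` and `i + 1` are exchanged, where both symbols occur and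
all occurrences of `i` are to the left of all occurrences of `i + 1`. -/
def StepUp (σ ρ : ℕ → ℕ∞) : Prop :=
  ∃ i : ℕ, (∃ p, σ p = i) ∧ (∃ q, σ q = (i + 1 : ℕ)) ∧
    (∀ p q, σ p = i → σ q = (i + 1 : ℕ) → p < q) ∧
    ∀ p, ρ p = Equiv.swap (i : ℕ∞) ((i + 1 : ℕ) : ℕ∞) (σ p)

/-- The weak order: the reflexive and transitive closure of `StepUp`. For `k = 2` this is the left
weak Bruhat order (on the `*`-permutations with given positions of the stars). -/
def WeakLE : (ℕ → ℕ∞) → (ℕ → ℕ∞) → Prop := Relation.ReflTransGen StepUp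

/-- `132`-avoiding sequences. The middle term of the pattern may be a `*`; the others are
automatically concrete. -/
def Avoids132 (σ : ℕ → ℕ∞) : Prop :=
  ¬ ∃ a b c, a < b ∧ b < c ∧ σ a < σ c ∧ σ c < σ b

/-- `231`-avoiding sequences. -/
def Avoids231 (σ : ℕ → ℕ∞) : Prop :=
  ¬ ∃ a b c, a < b ∧ b < c ∧ σ c < σ a ∧ σ a < σ b

/-! ### Partitions of polygons

A sequence of polygons is placed along the points `0, 1, 2, …`: a polygon with `m + 1` vertices has
vertices `a, a + 1, …, a + m`, and the next polygon starts at `a + m`. A polygon with two vertices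
is a single edge, and all but finitely many polygons are of this kind. A partition is given by
the set of all edges and diagonals that are drawn, as pairs `(a, b)` with `a < b`. -/

/-- Sets of edges and diagonals that form a partition of a sequence of polygons into
`(k + 1)`-gons. -/
structure IsPolygonPartition (k : ℕ) (E : Set (ℕ × ℕ)) : Prop where
  lt : ∀ a b, (a, b) ∈ E → a < b
  /-- The sides `(a, a + 1)` of the polygons are drawn. -/
  side : ∀ a, (a, a + 1) ∈ E
  noncrossing : ∀ a b c d, (a, b) ∈ E → (c, d) ∈ E → ¬ (a < c ∧ c < b ∧ b < d)
  finite : {e ∈ E | e.1 + 1 < e.2}.Finite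
  /-- The cell directly below a drawn segment `(a, b)`, whose vertices are the points of `[a, b]`
  that are not cut off by another segment below `(a, b)`, is a `(k + 1)`-gon. -/
  cell : ∀ a b, (a, b) ∈ E → a + 1 < b →
    {v | a ≤ v ∧ v ≤ b ∧ ∀ c d, (c, d) ∈ E → c < v → v < d → c ≤ a ∧ b ≤ d}.ncard = k + 1

/-- The vertices `v ≥ 1` carry the terms of the sequence (the term at index `p` is at the vertex
`p + 1`), and the vertex `0` is treated as a star. -/
def vertexTerm (σ : ℕ → ℕ∞) : ℕ → ℕ∞
  | 0 => ⊤
  | p + 1 => σ p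

/-- The path after the locations of all symbols larger than `i` have been added. The initial path
runs through `0` and all stars. -/
def path (σ : ℕ → ℕ∞) (i : ℕ) : Set ℕ := {v | (i : ℕ∞) < vertexTerm σ v}

/-- The partition obtained from a `*`-sequence: the union of all the paths, where a path connects
its vertices in increasing order. No labels are kept. -/
def polygonPartition (σ : ℕ → ℕ∞) : Set (ℕ × ℕ) :=
  {e | ∃ i : ℕ, e.1 ∈ path σ i ∧ e.2 ∈ path σ i ∧ e.1 < e.2 ∧
    ∀ w, e.1 < w → w < e.2 → w ∉ path σ i}

end PolygonTamari

/-! Orient the defining relation as a rewriting step `Swap`: `i j → (j + k - 1) i` for `i < j`. Its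
two sides perform two independent operations in different orders. So a step changes neither the
unlabeled forest (`Swap.shape_eq`) nor the polygon partition (`Swap.wordPartition_eq`), and on star
sequences it is a step up (`Swap.stepUp`).

Every word rewrites upwards to a weakly decreasing word (`exists_top`) and is reached from below
from a word in which consecutive letters `a, b` satisfy `a ≤ b + (k - 1)` (`exists_bottom`). No
confluence argument is needed, since the invariants determine these normal forms. In the partition,
the first letter of a top word is the largest left endpoint of a long segment, and the first letter
of a bottom word is read off from the smallest right endpoint. In the forest, the last letter of a
top word is the index of the leftmost non-trivial tree. Induction gives `eq_of_top`, `eq_of_bottom`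
and `eq_of_shape_eq`. Hence the congruence, equality of forests and equality of partitions coincide,
and each class lies between its bottom word and its top word.

Star sequences and partitions are built from the first letter of a word: `i :: w` inserts a block of
ones (`insertOnes`) and glues a polygon (`extend`). Forests are built from the last letter.
Surjectivity holds because such a step can be undone: remove the block of ones, the polygon below a
shortest long segment, or the caret with the largest label. -/

namespace PolygonTamari

/-! ### Insertion of a block of slots -/

/-- The increasing map that leaves out the `k - 1` positions `i, …, i + (k - 1) - 1`. -/
def shift (k i p : ℕ) : ℕ := if p < i then p else p + (k - 1)

theorem shift_strictMono (k i : ℕ) : StrictMono (shift k i) := by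
  intro p q h
  unfold shift
  split_ifs <;> omega

theorem shift_lt_iff {k i p q : ℕ} : shift k i p < shift k i q ↔ p < q :=
  (shift_strictMono k i).lt_iff_lt

theorem shift_le_iff {k i p q : ℕ} : shift k i p ≤ shift k i q ↔ p ≤ q :=
  (shift_strictMono k i).le_iff_le

theorem shift_cases (k i p : ℕ) : (i ≤ p ∧ p < i + (k - 1)) ∨ ∃ q, p = shift k i q := by
  by_cases h : p < i
  · exact .inr ⟨p, by simp [shift, h]⟩
  by_cases h' : p < i + (k - 1)
  · exact .inl ⟨by omega, h'⟩
  · exact .inr ⟨p - (k - 1), by unfold shift; split_ifs <;> omega⟩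

theorem shift_succ_succ (k i p : ℕ) : shift k (i + 1) (p + 1) = shift k i p + 1 := by
  unfold shift
  split_ifs <;> omega

/-- Insertion of a block of `k - 1` ones at index `i`, after all terms have been increased by
one. -/
def insertOnes (k i : ℕ) (τ : ℕ → ℕ∞) (p : ℕ) : ℕ∞ :=
  if p < i then τ p + 1 else if p < i + (k - 1) then 1 else τ (p - (k - 1)) + 1

theorem fillSlots_cons (k i : ℕ) (w : List ℕ) :
    fillSlots k (i :: w) = insertOnes k i (fillSlots k w) := rfl

theorem insertOnes_shift (k i : ℕ) (τ : ℕ → ℕ∞) (p : ℕ) :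
    insertOnes k i τ (shift k i p) = τ p + 1 := by
  unfold insertOnes shift
  split_ifs <;> first | rfl | omega | simp

theorem insertOnes_of_mem {k i p : ℕ} (τ : ℕ → ℕ∞) (h : i ≤ p) (h' : p < i + (k - 1)) :
    insertOnes k i τ p = 1 := by
  simp [insertOnes, h.not_gt, h']

theorem add_one_inj_enat {a b : ℕ∞} : a + 1 = b + 1 ↔ a = b :=
  WithTop.add_right_inj ENat.one_ne_top

theorem add_one_eq_succ_iff {a : ℕ∞} {j : ℕ} : a + 1 = ((j + 1 : ℕ) : ℕ∞) ↔ a = j := by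
  rw [Nat.cast_succ, add_one_inj_enat]

theorem add_one_le_add_one_enat {a b : ℕ∞} : a + 1 ≤ b + 1 ↔ a ≤ b :=
  WithTop.add_le_add_iff_right ENat.one_ne_top

theorem add_one_lt_add_one_enat {a b : ℕ∞} : a + 1 < b + 1 ↔ a < b :=
  WithTop.add_lt_add_iff_right ENat.one_ne_top

theorem one_le_insertOnes (k i : ℕ) (τ : ℕ → ℕ∞) (p : ℕ) : 1 ≤ insertOnes k i τ p := by
  unfold insertOnes
  split_ifs <;> simp

theorem fillSlots_ne_zero (k : ℕ) (w : List ℕ) (p : ℕ) : fillSlots k w p ≠ 0 := by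
  cases w with
  | nil => simp [fillSlots]
  | cons i w =>
    rw [fillSlots_cons]
    exact (zero_lt_one.trans_le (one_le_insertOnes k i _ p)).ne'

theorem insertOnes_eq_one_iff {k i : ℕ} {τ : ℕ → ℕ∞} (h0 : ∀ p, τ p ≠ 0) {p : ℕ} :
    insertOnes k i τ p = 1 ↔ i ≤ p ∧ p < i + (k - 1) := by
  refine ⟨fun h => ?_, fun h => insertOnes_of_mem τ h.1 h.2⟩
  rcases shift_cases k i p with h' | ⟨q, rfl⟩
  · exact h'
  · have h : τ q + 1 = 0 + 1 := by rw [← insertOnes_shift k i, h, zero_add]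
    rw [add_one_inj_enat] at h
    simp [h0] at h

/-! ### Star sequences -/

/-- Star sequences with concrete symbols `1, …, n`. -/
structure IsStarOfSize (k n : ℕ) (σ : ℕ → ℕ∞) : Prop where
  values : ∀ p, σ p = ⊤ ∨ ∃ j : ℕ, 1 ≤ j ∧ j ≤ n ∧ σ p = j
  ncard : ∀ j : ℕ, 1 ≤ j → j ≤ n → {p | σ p = j}.ncard = k - 1
  between : ∀ a b c, a < b → b < c → σ a = σ c → σ a ≠ ⊤ → σ b ≤ σ a

theorem isStarSequence_iff {k : ℕ} {σ : ℕ → ℕ∞} :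
    IsStarSequence k σ ↔ ∃ n, IsStarOfSize k n σ :=
  ⟨fun ⟨⟨n, h1, h2⟩, h3⟩ => ⟨n, h1, h2, h3⟩, fun ⟨n, h1, h2, h3⟩ => ⟨⟨n, h1, h2⟩, h3⟩⟩

theorem IsStarOfSize.ne_zero {k n : ℕ} {σ : ℕ → ℕ∞} (h : IsStarOfSize k n σ) (p : ℕ) :
    σ p ≠ 0 := by
  rcases h.values p with h | ⟨j, hj, -, h⟩
  · simp [h]
  · rw [h]
    exact_mod_cast (by omega : j ≠ 0)

theorem setOf_insertOnes_eq {k i : ℕ} (τ : ℕ → ℕ∞) {j : ℕ} (hj : 1 ≤ j) :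
    {p | insertOnes k i τ p = ((j + 1 : ℕ) : ℕ∞)} = shift k i '' {p | τ p = j} := by
  ext p
  simp only [Set.mem_ofPred_eq, Set.mem_image]
  constructor
  · intro h
    rcases shift_cases k i p with h' | ⟨q, rfl⟩
    · rw [insertOnes_of_mem τ h'.1 h'.2] at h
      have : 1 = j + 1 := by exact_mod_cast h
      omega
    · exact ⟨q, by rwa [insertOnes_shift, add_one_eq_succ_iff] at h, rfl⟩
  · rintro ⟨q, hq, rfl⟩
    rw [insertOnes_shift, add_one_eq_succ_iff, hq]

theorem isStarOfSize_insertOnes {k n i : ℕ} {τ : ℕ → ℕ∞} (h : IsStarOfSize k n τ) :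
    IsStarOfSize k (n + 1) (insertOnes k i τ) := by
  refine ⟨fun p => ?_, fun j h1 hn => ?_, fun a b c hab hbc hac htop => ?_⟩
  · rcases shift_cases k i p with h' | ⟨q, rfl⟩
    · exact .inr ⟨1, le_rfl, by omega, by rw [insertOnes_of_mem τ h'.1 h'.2]; rfl⟩
    · rw [insertOnes_shift]
      rcases h.values q with hq | ⟨j, h1, hn, hq⟩
      · exact .inl (by simp [hq])
      · exact .inr ⟨j + 1, by omega, by omega, by simp [hq]⟩
  · obtain ⟨j, rfl⟩ := Nat.exists_eq_add_of_le' h1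
    rcases Nat.eq_zero_or_pos j with rfl | hj
    · have : {p | insertOnes k i τ p = ((0 + 1 : ℕ) : ℕ∞)} = Finset.Ico i (i + (k - 1)) := by
        ext p
        simpa using insertOnes_eq_one_iff h.ne_zero
      rw [this, Set.ncard_coe_finset]
      simp
    · rw [setOf_insertOnes_eq τ hj, Set.ncard_image_of_injective _ (shift_strictMono k i).injective]
      exact h.ncard j hj (by omega)
  -- The ones are minimal and fill an interval: if `a` or `c` lies in the block, both do, and then
  -- so does `b`.
  · rcases shift_cases k i b with hb | ⟨b, rfl⟩
    · rw [insertOnes_of_mem τ hb.1 hb.2]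
      exact one_le_insertOnes ..
    rcases shift_cases k i a with ha | ⟨a, rfl⟩
    · have hc : insertOnes k i τ c = 1 := by rw [← hac, insertOnes_of_mem τ ha.1 ha.2]
      rw [insertOnes_eq_one_iff h.ne_zero] at hc
      rw [insertOnes_of_mem τ (ha.1.trans hab.le) (hbc.trans hc.2)]
      exact one_le_insertOnes ..
    rcases shift_cases k i c with hc | ⟨c, rfl⟩
    · rw [insertOnes_of_mem τ hc.1 hc.2, insertOnes_eq_one_iff h.ne_zero] at hac
      rw [insertOnes_of_mem τ (hac.1.trans hab.le) (hbc.trans hc.2)]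
      exact one_le_insertOnes ..
    simp only [insertOnes_shift, shift_lt_iff, add_one_inj_enat, add_one_le_add_one_enat] at *
    exact h.between a b c hab hbc hac fun h => htop (by simp [h])

theorem isStarOfSize_of_insertOnes {k n i : ℕ} {τ : ℕ → ℕ∞} (h0 : ∀ p, τ p ≠ 0)
    (h : IsStarOfSize k (n + 1) (insertOnes k i τ)) : IsStarOfSize k n τ := by
  refine ⟨fun p => ?_, fun j h1 hn => ?_, fun a b c hab hbc hac htop => ?_⟩
  · have h1 := h.values (shift k i p)
    rw [insertOnes_shift] at h1
    rcases h1 with hp | ⟨j, h1, hn, hp⟩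
    · exact .inl (by simpa using hp)
    · obtain ⟨j, rfl⟩ := Nat.exists_eq_add_of_le' h1
      rw [add_one_eq_succ_iff] at hp
      refine .inr ⟨j, Nat.one_le_iff_ne_zero.2 fun hj => h0 p ?_, by omega, hp⟩
      simp [hp, hj]
  · have := h.ncard (j + 1) (by omega) (by omega)
    rwa [setOf_insertOnes_eq τ h1,
      Set.ncard_image_of_injective _ (shift_strictMono k i).injective] at this
  · have := h.between (shift k i a) (shift k i b) (shift k i c) (shift_lt_iff.2 hab)
      (shift_lt_iff.2 hbc)
    simp only [insertOnes_shift, add_one_inj_enat, add_one_le_add_one_enat] at this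
    exact this hac (by simpa using htop)

theorem exists_eq_Ico {k : ℕ} (hk : 2 ≤ k) {S : Set ℕ} (hS : S.ncard = k - 1)
    (hconn : ∀ a b c, a < b → b < c → a ∈ S → c ∈ S → b ∈ S) :
    ∃ i, ∀ p, p ∈ S ↔ i ≤ p ∧ p < i + (k - 1) := by
  have hfin : S.Finite := Set.finite_of_ncard_pos (by omega)
  have hne : S.Nonempty := Set.nonempty_of_ncard_ne_zero (by omega)
  obtain ⟨i, hi, hmin⟩ := Set.exists_min_image S id hfin hne
  obtain ⟨j, hj, hmax⟩ := Set.exists_max_image S id hfin hne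
  have key : S = Finset.Icc i j := by
    ext p
    simp only [Finset.coe_Icc, Set.mem_Icc]
    refine ⟨fun h => ⟨hmin p h, hmax p h⟩, fun ⟨h1, h2⟩ => ?_⟩
    rcases h1.eq_or_lt with rfl | h1
    · exact hi
    rcases h2.eq_or_lt with rfl | h2
    · exact hj
    exact hconn i p j h1 h2 hi hj
  rw [key, Set.ncard_coe_finset, Nat.card_Icc] at hS
  refine ⟨i, fun p => ?_⟩
  rw [key]
  simp only [Finset.coe_Icc, Set.mem_Icc]
  omega

/-- Between two ones only ones can occur, so the ones fill an interval of length `k - 1`, which can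
be removed. All terms are at least `1`, so lowering the remaining ones by truncated subtraction
loses nothing. -/
theorem IsStarOfSize.exists_insertOnes {k n : ℕ} (hk : 2 ≤ k) {σ : ℕ → ℕ∞}
    (h : IsStarOfSize k (n + 1) σ) :
    ∃ i τ, σ = insertOnes k i τ ∧ IsStarOfSize k n τ := by
  have hpos : ∀ p, 1 ≤ σ p := fun p => Order.one_le_iff_pos.2 (pos_iff_ne_zero.2 (h.ne_zero p))
  obtain ⟨i, hi⟩ := exists_eq_Ico hk (h.ncard 1 le_rfl (by omega)) fun a b c hab hbc ha hc => by
    simp only [Set.mem_ofPred_eq, Nat.cast_one] at *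
    have := h.between a b c hab hbc (by rw [ha, hc]) (by simp [ha])
    exact le_antisymm (this.trans ha.le) (hpos b)
  simp only [Set.mem_ofPred_eq, Nat.cast_one] at hi
  have hσ : σ = insertOnes k i (fun p => σ (shift k i p) - 1) := by
    funext p
    rcases shift_cases k i p with h' | ⟨q, rfl⟩
    · rw [insertOnes_of_mem _ h'.1 h'.2, (hi p).2 h']
    · rw [insertOnes_shift, tsub_add_cancel_of_le (hpos _)]
  refine ⟨i, _, hσ, isStarOfSize_of_insertOnes (i := i) (fun p hp => ?_) (hσ ▸ h)⟩
  have h1 : σ (shift k i p) = 1 := le_antisymm (tsub_eq_zero_iff_le.1 hp) (hpos _)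
  have := (hi _).1 h1
  unfold shift at this
  split_ifs at this <;> omega

theorem isStarOfSize_fillSlots (k : ℕ) (w : List ℕ) :
    IsStarOfSize k w.length (fillSlots k w) := by
  induction w with
  | nil => exact ⟨fun p => .inl rfl, fun j h1 h2 => by simp at h2; omega, by simp [fillSlots]⟩
  | cons i w ih => exact isStarOfSize_insertOnes ih

theorem IsStarOfSize.exists_fillSlots {k n : ℕ} (hk : 2 ≤ k) {σ : ℕ → ℕ∞}
    (h : IsStarOfSize k n σ) : ∃ w, fillSlots k w = σ := by
  induction n generalizing σ with
  | zero =>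
    refine ⟨[], funext fun p => ?_⟩
    rcases h.values p with hp | ⟨j, h1, h2, -⟩
    · exact hp.symm
    · omega
  | succ n ih =>
    obtain ⟨i, τ, rfl, hτ⟩ := h.exists_insertOnes hk
    obtain ⟨w, rfl⟩ := ih hτ
    exact ⟨i :: w, rfl⟩

/-- The first letter is the start of the block of ones, which is non-empty because `2 ≤ k`. -/
theorem fillSlots_injective {k : ℕ} (hk : 2 ≤ k) : Function.Injective (fillSlots k) := by
  intro v
  induction v with
  | nil =>
    rintro (_ | ⟨i, w⟩) h
    · rfl
    · have := congrFun h i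
      rw [fillSlots_cons, insertOnes_of_mem _ le_rfl (by omega)] at this
      simp [fillSlots] at this
  | cons i v ih =>
    rintro (_ | ⟨j, w⟩) h
    · have := congrFun h i
      rw [fillSlots_cons, insertOnes_of_mem _ le_rfl (by omega)] at this
      simp [fillSlots] at this
    · rw [fillSlots_cons, fillSlots_cons] at h
      have hiff : ∀ p, (i ≤ p ∧ p < i + (k - 1)) ↔ (j ≤ p ∧ p < j + (k - 1)) := fun p => by
        rw [← insertOnes_eq_one_iff (fillSlots_ne_zero k v), h,
          insertOnes_eq_one_iff (fillSlots_ne_zero k w)]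
      have h1 := hiff i
      have h2 := hiff j
      obtain rfl : i = j := by omega
      rw [ih (funext fun p => ?_)]
      have := congrFun h (shift k i p)
      rwa [insertOnes_shift, insertOnes_shift, add_one_inj_enat] at this

theorem bijOn_starSequence {k : ℕ} (hk : 2 ≤ k) :
    Set.BijOn (starSequence k) Set.univ {σ | IsStarSequence k σ} := by
  refine ⟨fun u _ => isStarSequence_iff.2 ⟨_, isStarOfSize_fillSlots k u.toList⟩,
    fun u _ v _ h => FreeMonoid.toList.injective (fillSlots_injective hk h), fun σ hσ => ?_⟩
  obtain ⟨n, hn⟩ := isStarSequence_iff.1 hσ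
  obtain ⟨w, hw⟩ := hn.exists_fillSlots hk
  exact ⟨FreeMonoid.ofList w, trivial, hw⟩

/-! ### Rewriting of words -/

/-- Application of one relation `x_i x_j = x_{j+k-1} x_i`, `i < j`, from left to right. -/
inductive Swap (k : ℕ) : List ℕ → List ℕ → Prop
  | head (i j : ℕ) (w : List ℕ) (h : i < j) : Swap k (i :: j :: w) ((j + (k - 1)) :: i :: w)
  | cons (i : ℕ) {v w : List ℕ} (h : Swap k v w) : Swap k (i :: v) (i :: w)

theorem Swap.append_right {k : ℕ} {v w : List ℕ} (h : Swap k v w) (b : List ℕ) :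
    Swap k (v ++ b) (w ++ b) := by
  induction h with
  | head i j w h => exact .head i j _ h
  | cons i _ ih => exact .cons i ih

theorem Swap.append_left {k : ℕ} {v w : List ℕ} (h : Swap k v w) (a : List ℕ) :
    Swap k (a ++ v) (a ++ w) := by
  induction a with
  | nil => exact h
  | cons i _ ih => exact .cons i ih

theorem Swap.conGen {k : ℕ} {v w : List ℕ} (h : Swap k v w) :
    conGen (ThompsonRel k) (FreeMonoid.ofList v) (FreeMonoid.ofList w) := by
  induction h with
  | head i j w h =>
    exact (_root_.conGen (ThompsonRel k)).mul (ConGen.Rel.of _ _ (.swap i j h))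
      ((_root_.conGen (ThompsonRel k)).refl (FreeMonoid.ofList w))
  | cons i _ ih =>
    exact (_root_.conGen (ThompsonRel k)).mul
      ((_root_.conGen (ThompsonRel k)).refl (FreeMonoid.of i)) ih

theorem conGen_of_reflTransGen {k : ℕ} {v w : List ℕ} (h : Relation.ReflTransGen (Swap k) v w) :
    conGen (ThompsonRel k) (FreeMonoid.ofList v) (FreeMonoid.ofList w) := by
  induction h with
  | refl => exact (conGen (ThompsonRel k)).refl _
  | tail _ h ih => exact (conGen (ThompsonRel k)).trans ih h.conGen

/-- A function on words that is invariant under `Swap` is invariant under the congruence that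
defines the Thompson monoid. -/
theorem eq_of_conGen {k : ℕ} {β : Type} (F : List ℕ → β)
    (hF : ∀ v w, Swap k v w → F v = F w) {u v : FreeMonoid ℕ}
    (h : conGen (ThompsonRel k) u v) : F u.toList = F v.toList := by
  -- `F` need not be multiplicative; the surrounding words `a` and `b` make the induction pass
  -- through products.
  suffices H : ∀ a b : List ℕ, F (a ++ u.toList ++ b) = F (a ++ v.toList ++ b) by
    simpa using H [] []
  have h' : ConGen.Rel (ThompsonRel k) u v := h
  clear h
  induction h' with
  | of u v h =>
    intro a b
    cases h with
    | swap i j hij => exact hF _ _ (((Swap.head i j [] hij).append_left a).append_right b)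
  | refl => exact fun _ _ => rfl
  | symm _ ih => exact fun a b => (ih a b).symm
  | trans _ _ ih1 ih2 => exact fun a b => (ih1 a b).trans (ih2 a b)
  | mul _ _ ih1 ih2 =>
    rename_i w x y z _ _
    intro a b
    simp only [FreeMonoid.toList_mul]
    have e1 := ih1 a (y.toList ++ b)
    have e2 := ih2 (a ++ x.toList) b
    simp only [List.append_assoc] at *
    rw [e1, e2]

theorem reflTransGen_cons {k : ℕ} {v w : List ℕ} (i : ℕ)
    (h : Relation.ReflTransGen (Swap k) v w) :
    Relation.ReflTransGen (Swap k) (i :: v) (i :: w) :=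
  h.lift _ fun _ _ h => .cons i h

/-- The words to which no relation can be applied from left to right. -/
abbrev IsTop (w : List ℕ) : Prop := w.Pairwise (· ≥ ·)

/-- The words to which no relation can be applied from right to left. -/
abbrev IsBottom (k : ℕ) (w : List ℕ) : Prop := w.IsChain fun a b => a ≤ b + (k - 1)

/-- Insertion sort: `i` moves right past the larger letters and raises each of them by `k - 1`. The
bound `M` shows that a raised letter placed in front still dominates the rest. -/
theorem exists_top_cons (k i : ℕ) {t : List ℕ} (ht : IsTop t) :
    ∃ s, Relation.ReflTransGen (Swap k) (i :: t) s ∧ IsTop s ∧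
      ∀ M, i ≤ M → (∀ x ∈ t, x + (k - 1) ≤ M) → ∀ x ∈ s, x ≤ M := by
  induction t with
  | nil => exact ⟨[i], .refl, by simp [IsTop], by simp⟩
  | cons j t ih =>
    obtain ⟨hj, ht'⟩ := List.pairwise_cons.1 ht
    by_cases hij : i < j
    · obtain ⟨s, hs, hs', hM⟩ := ih ht'
      refine ⟨(j + (k - 1)) :: s, .head (.head i j t hij) (reflTransGen_cons _ hs),
        List.pairwise_cons.2 ⟨hM _ (by omega) fun x hx => by have := hj x hx; omega, hs'⟩, ?_⟩
      intro M hi hx x hxs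
      rcases List.mem_cons.1 hxs with rfl | hxs
      · exact hx j (by simp)
      · exact hM M hi (fun y hy => hx y (by simp [hy])) x hxs
    · refine ⟨i :: j :: t, .refl, List.pairwise_cons.2 ⟨fun x hx => ?_, ht⟩, ?_⟩
      · rcases List.mem_cons.1 hx with rfl | hx
        · omega
        · have := hj x hx
          omega
      · intro M hi hx x hxs
        rcases List.mem_cons.1 hxs with rfl | hxs
        · exact hi
        · have := hx x hxs
          omega

theorem exists_top (k : ℕ) (w : List ℕ) :
    ∃ t, Relation.ReflTransGen (Swap k) w t ∧ IsTop t := by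
  induction w with
  | nil => exact ⟨[], .refl, List.Pairwise.nil⟩
  | cons i w ih =>
    obtain ⟨t, hwt, ht⟩ := ih
    obtain ⟨s, hts, hs, -⟩ := exists_top_cons k i ht
    exact ⟨s, (reflTransGen_cons i hwt).trans hts, hs⟩

/-- Inverse sorting: as long as `i > j + (k - 1)` for the next letter `j`, the letter `i` moves past
`j` and drops by `k - 1`. The last clause lets the skipped letter be put back in front, since `s`
starts with `i` or with the first letter of `t`. -/
theorem exists_bottom_cons (k i : ℕ) {t : List ℕ} (ht : IsBottom k t) :
    ∃ s, Relation.ReflTransGen (Swap k) s (i :: t) ∧ IsBottom k s ∧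
      ∀ b, b ≤ i → IsBottom k (b :: t) → IsBottom k (b :: s) := by
  induction t generalizing i with
  | nil =>
    refine ⟨[i], .refl, by simp [IsBottom], fun b hb _ => ?_⟩
    simp only [IsBottom, List.isChain_cons_cons, List.isChain_singleton, and_true]
    omega
  | cons j t ih =>
    by_cases hij : i ≤ j + (k - 1)
    · refine ⟨i :: j :: t, .refl, List.isChain_cons_cons.2 ⟨hij, ht⟩, fun b hb _ => ?_⟩
      exact List.isChain_cons_cons.2 ⟨by omega, List.isChain_cons_cons.2 ⟨hij, ht⟩⟩
    · obtain ⟨s, hs, -, hb⟩ := ih (i - (k - 1)) ht.tail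
      have hsw := Swap.head (k := k) j (i - (k - 1)) t (by omega)
      rw [Nat.sub_add_cancel (by omega)] at hsw
      have hjs : IsBottom k (j :: s) := hb j (by omega) ht
      refine ⟨j :: s, (reflTransGen_cons j hs).tail hsw, hjs, fun b _ hbt => ?_⟩
      exact List.isChain_cons_cons.2 ⟨(List.isChain_cons_cons.1 hbt).1, hjs⟩

theorem exists_bottom (k : ℕ) (w : List ℕ) :
    ∃ t, Relation.ReflTransGen (Swap k) t w ∧ IsBottom k t := by
  induction w with
  | nil => exact ⟨[], .refl, List.IsChain.nil⟩
  | cons i w ih =>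
    obtain ⟨t, hwt, ht⟩ := ih
    obtain ⟨s, hts, hs, -⟩ := exists_bottom_cons k i ht
    exact ⟨s, hts.trans (reflTransGen_cons i hwt), hs⟩

/-! ### Rewriting steps are steps up in the weak order -/

theorem swap_add_one (i : ℕ) (a : ℕ∞) :
    Equiv.swap ((i + 1 : ℕ) : ℕ∞) ((i + 1 + 1 : ℕ) : ℕ∞) (a + 1) =
      Equiv.swap (i : ℕ∞) ((i + 1 : ℕ) : ℕ∞) a + 1 := by
  simp only [Equiv.swap_apply_def, add_one_eq_succ_iff]
  split_ifs <;> simp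

theorem insertOnes_ne_zero (k i : ℕ) (τ : ℕ → ℕ∞) (p : ℕ) : insertOnes k i τ p ≠ 0 :=
  (zero_lt_one.trans_le (one_le_insertOnes k i τ p)).ne'

/-- An exchange of `j` and `j + 1` becomes one of `j + 1` and `j + 2`. As `0` does not occur, `j ≥
1`, so the new ones are not involved. -/
theorem StepUp.insertOnes {k i : ℕ} {σ ρ : ℕ → ℕ∞} (h : StepUp σ ρ) (hσ : ∀ p, σ p ≠ 0) :
    StepUp (insertOnes k i σ) (insertOnes k i ρ) := by
  obtain ⟨j, ⟨p, hp⟩, ⟨q, hq⟩, hlt, hρ⟩ := h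
  have hj : 1 ≤ j := Nat.one_le_iff_ne_zero.2 fun h => hσ p (by simp [hp, h])
  have hset := fun (l : ℕ) (hl : 1 ≤ l) (x : ℕ) =>
    Set.ext_iff.1 (setOf_insertOnes_eq (k := k) (i := i) σ hl) x
  simp only [Set.mem_ofPred_eq, Set.mem_image] at hset
  refine ⟨j + 1, ⟨shift k i p, ?_⟩, ⟨shift k i q, ?_⟩, fun a b ha hb => ?_, fun a => ?_⟩
  · rw [insertOnes_shift, add_one_eq_succ_iff, hp]
  · rw [insertOnes_shift, add_one_eq_succ_iff, hq]
  · obtain ⟨a, ha', rfl⟩ := (hset j hj a).1 ha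
    obtain ⟨b, hb', rfl⟩ := (hset (j + 1) (by omega) b).1 hb
    exact shift_lt_iff.2 (hlt a b ha' hb')
  · rcases shift_cases k i a with ha | ⟨a, rfl⟩
    · rw [insertOnes_of_mem _ ha.1 ha.2, insertOnes_of_mem _ ha.1 ha.2,
        Equiv.swap_apply_of_ne_of_ne]
      · exact_mod_cast (by omega : 1 ≠ j + 1)
      · exact_mod_cast (by omega : 1 ≠ j + 1 + 1)
    · rw [insertOnes_shift, insertOnes_shift, swap_add_one, hρ]

/-- Two disjoint blocks may be left out in either order; in the presence of the left block, the
right one starts at `j + (k - 1)`. This is the source of the index in the defining relation. -/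
theorem shift_shift {k i j : ℕ} (h : i < j) (p : ℕ) :
    shift k i (shift k j p) = shift k (j + (k - 1)) (shift k i p) := by
  unfold shift
  split_ifs <;> omega

/-- Both sequences have blocks at `i` and `j + (k - 1)` and agree elsewhere; the blocks carry `1, 2`
on one side and `2, 1` on the other. -/
theorem stepUp_insertOnes_insertOnes {k i j : ℕ} (hk : 2 ≤ k) (h : i < j) {τ : ℕ → ℕ∞}
    (hτ : ∀ p, τ p ≠ 0) :
    StepUp (insertOnes k i (insertOnes k j τ))
      (insertOnes k (j + (k - 1)) (insertOnes k i τ)) := by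
  have h1 : ∀ p, insertOnes k i (insertOnes k j τ) p = ((1 : ℕ) : ℕ∞) ↔
      i ≤ p ∧ p < i + (k - 1) := fun p => by
    rw [Nat.cast_one, insertOnes_eq_one_iff (insertOnes_ne_zero k j τ)]
  have h2 : ∀ p, insertOnes k i (insertOnes k j τ) p = ((1 + 1 : ℕ) : ℕ∞) →
      j + (k - 1) ≤ p := fun p hp => by
    obtain ⟨q, hq, rfl⟩ := (Set.ext_iff.1 (setOf_insertOnes_eq (k := k) (i := i) _ le_rfl) p).1 hp
    have hq : insertOnes k j τ q = 1 := by simpa using hq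
    rw [insertOnes_eq_one_iff hτ] at hq
    unfold shift
    split_ifs <;> omega
  refine ⟨1, ⟨i, (h1 i).2 (by omega)⟩, ⟨shift k i j, ?_⟩, fun p q hp hq => ?_, fun p => ?_⟩
  · rw [insertOnes_shift, insertOnes_of_mem τ le_rfl (by omega)]
    norm_num
  · have := (h1 p).1 hp
    have := h2 q hq
    omega
  · rcases shift_cases k i p with hp | ⟨q, rfl⟩
    · rw [(h1 p).2 hp, Equiv.swap_apply_left]
      have : p = shift k (j + (k - 1)) p := by
        unfold shift
        split_ifs <;> omega
      rw [this, insertOnes_shift, insertOnes_of_mem τ hp.1 hp.2]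
      norm_num
    rcases shift_cases k j q with hq | ⟨r, rfl⟩
    · rw [insertOnes_of_mem, insertOnes_shift, insertOnes_of_mem τ hq.1 hq.2]
      · rw [one_add_one_eq_two]
        exact (Equiv.swap_apply_right _ _).symm
      all_goals unfold shift; split_ifs <;> omega
    · rw [insertOnes_shift, insertOnes_shift, shift_shift h, insertOnes_shift, insertOnes_shift,
        Equiv.swap_apply_of_ne_of_ne]
      · intro h
        have := (add_one_eq_succ_iff (j := 0)).1 h
        simp at this
      · intro h
        exact hτ r ((add_one_eq_succ_iff (j := 0)).1 ((add_one_eq_succ_iff (j := 1)).1 h))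

theorem Swap.stepUp {k : ℕ} (hk : 2 ≤ k) {v w : List ℕ} (h : Swap k v w) :
    StepUp (fillSlots k v) (fillSlots k w) := by
  induction h with
  | head i j w h => exact stepUp_insertOnes_insertOnes hk h (fillSlots_ne_zero k w)
  | cons i _ ih => exact ih.insertOnes (fillSlots_ne_zero k _)

theorem weakLE_of_reflTransGen {k : ℕ} (hk : 2 ≤ k) {v w : List ℕ}
    (h : Relation.ReflTransGen (Swap k) v w) : WeakLE (fillSlots k v) (fillSlots k w) :=
  h.lift _ fun _ _ h => h.stepUp hk

/-! ### Pattern avoidance -/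

/-- The next letter `j` satisfies `j ≤ i`, so from `i` on there is at most a piece of the block of
ones, followed by terms to which induction applies. -/
theorem fillSlots_le_of_top {k i : ℕ} {w : List ℕ} (hw : IsTop (i :: w)) {p q : ℕ} (hp : i ≤ p)
    (hpq : p ≤ q) : fillSlots k w p ≤ fillSlots k w q := by
  induction w generalizing i p q with
  | nil => simp [fillSlots]
  | cons j w ih =>
    obtain ⟨hi, hw⟩ := List.pairwise_cons.1 hw
    have hj : j ≤ i := hi j (by simp)
    rw [fillSlots_cons]
    rcases shift_cases k j p with hp' | ⟨p, rfl⟩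
    · rw [insertOnes_of_mem _ hp'.1 hp'.2]
      exact one_le_insertOnes ..
    rcases shift_cases k j q with hq' | ⟨q, rfl⟩
    · unfold shift at *
      split_ifs at * <;> omega
    rw [insertOnes_shift, insertOnes_shift, add_one_le_add_one_enat]
    refine ih hw ?_ (shift_le_iff.1 hpq)
    unfold shift at hp
    split_ifs at hp <;> omega

/-- A minimal symbol `1` can only be the first term of the pattern; then the other two terms form a
descent to the right of the block, where the sequence increases weakly. -/
theorem avoids132_of_top {k : ℕ} {w : List ℕ} (hw : IsTop w) : Avoids132 (fillSlots k w) := by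
  induction w with
  | nil => simp [Avoids132, fillSlots]
  | cons i w ih =>
    rintro ⟨a, b, c, hab, hbc, hac, hcb⟩
    rw [fillSlots_cons] at *
    rcases shift_cases k i c with hc | ⟨c, rfl⟩
    · rw [insertOnes_of_mem _ hc.1 hc.2] at hac
      exact hac.not_ge (one_le_insertOnes ..)
    rcases shift_cases k i b with hb | ⟨b, rfl⟩
    · rw [insertOnes_of_mem _ hb.1 hb.2] at hcb
      exact hcb.not_ge (one_le_insertOnes ..)
    rw [insertOnes_shift, insertOnes_shift, add_one_lt_add_one_enat] at hcb
    have hbc := shift_lt_iff.1 hbc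
    rcases shift_cases k i a with ha | ⟨a, rfl⟩
    · refine hcb.not_ge (fillSlots_le_of_top hw ?_ hbc.le)
      unfold shift at hab
      split_ifs at hab <;> omega
    · rw [insertOnes_shift, insertOnes_shift, add_one_lt_add_one_enat] at hac
      exact ih hw.tail ⟨a, b, c, shift_lt_iff.1 hab, hbc, hac, hcb⟩

/-- Since `i ≤ j + (k - 1)`, no index below `i` is beyond the block of the next letter `j`. So any
ones come last, and induction applies to the indices below `j`. -/
theorem fillSlots_ge_of_bottom {k i : ℕ} {w : List ℕ} (hw : IsBottom k (i :: w)) {p q : ℕ}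
    (hpq : p ≤ q) (hq : q < i) : fillSlots k w q ≤ fillSlots k w p := by
  induction w generalizing i p q with
  | nil => simp [fillSlots]
  | cons j w ih =>
    obtain ⟨hij, hw⟩ := List.isChain_cons_cons.1 hw
    rw [fillSlots_cons]
    rcases shift_cases k j q with hq' | ⟨q, rfl⟩
    · rw [insertOnes_of_mem _ hq'.1 hq'.2]
      exact one_le_insertOnes ..
    have hqj : q < j := by
      unfold shift at hq
      split_ifs at hq <;> omega
    rcases shift_cases k j p with hp' | ⟨p, rfl⟩
    · unfold shift at *
      split_ifs at *
      omega
    rw [insertOnes_shift, insertOnes_shift, add_one_le_add_one_enat]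
    exact ih hw (shift_le_iff.1 hpq) hqj

/-- Here a `1` can only be the last term of the pattern, and the other two would form an ascent to
the left of the block. -/
theorem avoids231_of_bottom {k : ℕ} {w : List ℕ} (hw : IsBottom k w) :
    Avoids231 (fillSlots k w) := by
  induction w with
  | nil => simp [Avoids231, fillSlots]
  | cons i w ih =>
    rintro ⟨a, b, c, hab, hbc, hca, hac⟩
    rw [fillSlots_cons] at *
    rcases shift_cases k i a with ha | ⟨a, rfl⟩
    · rw [insertOnes_of_mem _ ha.1 ha.2] at hca
      exact hca.not_ge (one_le_insertOnes ..)
    rcases shift_cases k i b with hb | ⟨b, rfl⟩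
    · rw [insertOnes_of_mem _ hb.1 hb.2] at hac
      exact hac.not_ge (one_le_insertOnes ..)
    rw [insertOnes_shift, insertOnes_shift, add_one_lt_add_one_enat] at hac
    have hab := shift_lt_iff.1 hab
    rcases shift_cases k i c with hc | ⟨c, rfl⟩
    · refine hac.not_ge (fillSlots_ge_of_bottom hw hab.le ?_)
      unfold shift at hbc
      split_ifs at hbc <;> omega
    · rw [insertOnes_shift, insertOnes_shift, add_one_lt_add_one_enat] at hca
      exact ih hw.tail ⟨a, b, c, hab, shift_lt_iff.1 hbc, hca, hac⟩

/-! ### Polygon partitions -/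

/-- A new `(k + 1)`-gon with sides `(i, i + 1), …, (i + k - 1, i + k)` is glued to the segment
`(i, i + 1)`, after the other vertices have been renumbered; then all sides are drawn. -/
def extend (k i : ℕ) (E : Set (ℕ × ℕ)) : Set (ℕ × ℕ) :=
  {e | e.2 = e.1 + 1 ∨ ∃ c d, (c, d) ∈ E ∧ e.1 = shift k (i + 1) c ∧ e.2 = shift k (i + 1) d}

theorem mem_extend {k i a b : ℕ} {E : Set (ℕ × ℕ)} : (a, b) ∈ extend k i E ↔
    b = a + 1 ∨ ∃ c d, (c, d) ∈ E ∧ a = shift k (i + 1) c ∧ b = shift k (i + 1) d := Iff.rfl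

theorem shift_mem_extend {k i a b : ℕ} {E : Set (ℕ × ℕ)} (h : (a, b) ∈ E) :
    (shift k (i + 1) a, shift k (i + 1) b) ∈ extend k i E :=
  .inr ⟨a, b, h, rfl, rfl⟩

theorem shift_inj {k i p q : ℕ} : shift k i p = shift k i q ↔ p = q :=
  (shift_strictMono k i).injective.eq_iff

theorem shift_mem_extend_iff {k i a b : ℕ} {E : Set (ℕ × ℕ)} (hE : ∀ a, (a, a + 1) ∈ E) :
    (shift k (i + 1) a, shift k (i + 1) b) ∈ extend k i E ↔ (a, b) ∈ E := by
  refine ⟨?_, shift_mem_extend⟩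
  rintro (h | ⟨c, d, h, h1, h2⟩)
  · simp only at h
    have : b = a + 1 := by
      unfold shift at h
      split_ifs at h <;> omega
    exact this ▸ hE a
  · simp only [shift_inj] at h1 h2
    rwa [h1, h2]

theorem shift_self (k i : ℕ) : shift k (i + 1) i = i := by simp [shift]

theorem shift_succ_self {k : ℕ} (hk : 2 ≤ k) (i : ℕ) : shift k (i + 1) (i + 1) = i + k := by
  simp only [shift, lt_irrefl, if_false]
  omega

theorem vertexTerm_insertOnes_shift (k i : ℕ) (τ : ℕ → ℕ∞) (v : ℕ) :
    vertexTerm (insertOnes k i τ) (shift k (i + 1) v) = vertexTerm τ v + 1 := by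
  cases v with
  | zero => simp [shift, vertexTerm]
  | succ p =>
    rw [shift_succ_succ]
    exact insertOnes_shift k i τ p

theorem vertexTerm_insertOnes_of_mem {k i v : ℕ} (τ : ℕ → ℕ∞) (h : i + 1 ≤ v)
    (h' : v < i + 1 + (k - 1)) : vertexTerm (insertOnes k i τ) v = 1 := by
  obtain ⟨v, rfl⟩ := Nat.exists_eq_add_of_le' (show 1 ≤ v by omega)
  exact insertOnes_of_mem τ (by omega) (by omega)

theorem mem_path_insertOnes_zero (k i : ℕ) (τ : ℕ → ℕ∞) (v : ℕ) :
    v ∈ path (insertOnes k i τ) 0 := by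
  cases v with
  | zero => simp [path, vertexTerm]
  | succ p => exact zero_lt_one.trans_le (one_le_insertOnes k i τ p)

theorem shift_mem_path_iff {k i j v : ℕ} {τ : ℕ → ℕ∞} :
    shift k (i + 1) v ∈ path (insertOnes k i τ) (j + 1) ↔ v ∈ path τ j := by
  simp only [path, Set.mem_ofPred_eq, vertexTerm_insertOnes_shift, Nat.cast_succ,
    add_one_lt_add_one_enat]

theorem exists_of_mem_path {k i j v : ℕ} {τ : ℕ → ℕ∞}
    (h : v ∈ path (insertOnes k i τ) (j + 1)) : ∃ w, v = shift k (i + 1) w := by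
  rcases shift_cases k (i + 1) v with hv | hv
  · simp only [path, Set.mem_ofPred_eq, vertexTerm_insertOnes_of_mem τ hv.1 hv.2] at h
    have : j + 1 < 1 := by exact_mod_cast h
    omega
  · exact hv

/-- The path at level `0` visits every vertex and draws the sides. The path at level `j + 1` misses
the new vertices and is the shifted path of `τ` at level `j`. -/
theorem polygonPartition_insertOnes (k i : ℕ) (τ : ℕ → ℕ∞) :
    polygonPartition (insertOnes k i τ) = extend k i (polygonPartition τ) := by
  ext ⟨a, b⟩
  constructor
  · rintro ⟨j, ha, hb, hab, hw⟩
    simp only at ha hb hab hw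
    cases j with
    | zero =>
      left
      by_contra hne
      simp only at hne
      exact hw (a + 1) (by omega) (by omega) (mem_path_insertOnes_zero ..)
    | succ j =>
      obtain ⟨c, rfl⟩ := exists_of_mem_path ha
      obtain ⟨d, rfl⟩ := exists_of_mem_path hb
      rw [shift_mem_path_iff] at ha hb
      refine shift_mem_extend ⟨j, ha, hb, shift_lt_iff.1 hab, fun w h1 h2 h => ?_⟩
      exact hw _ (shift_lt_iff.2 h1) (shift_lt_iff.2 h2) (shift_mem_path_iff.2 h)
  · rintro (h | ⟨c, d, ⟨j, hc, hd, hcd, hw⟩, rfl, rfl⟩)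
    · simp only at h
      exact ⟨0, mem_path_insertOnes_zero .., mem_path_insertOnes_zero .., by simp [h],
        fun w h1 h2 => by simp only at h1 h2; omega⟩
    · refine ⟨j + 1, shift_mem_path_iff.2 hc, shift_mem_path_iff.2 hd, shift_lt_iff.2 hcd,
        fun w h1 h2 h => ?_⟩
      obtain ⟨w, rfl⟩ := exists_of_mem_path h
      exact hw w (shift_lt_iff.1 h1) (shift_lt_iff.1 h2) (shift_mem_path_iff.1 h)

/-- The polygon partition of a word. -/
abbrev wordPartition (k : ℕ) (w : List ℕ) : Set (ℕ × ℕ) := polygonPartition (fillSlots k w)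

theorem wordPartition_cons (k i : ℕ) (w : List ℕ) :
    wordPartition k (i :: w) = extend k i (wordPartition k w) :=
  polygonPartition_insertOnes ..

theorem wordPartition_nil (k : ℕ) : wordPartition k [] = {e | e.2 = e.1 + 1} := by
  have hmem : ∀ v i, v ∈ path (fillSlots k []) i := fun v i => by
    cases v <;> simp [path, vertexTerm, fillSlots]
  ext ⟨a, b⟩
  constructor
  · rintro ⟨j, -, -, hab, hw⟩
    simp only at hab hw
    by_contra hne
    simp only [Set.mem_ofPred_eq] at hne
    exact hw (a + 1) (by omega) (by omega) (hmem ..)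
  · intro h
    simp only [Set.mem_ofPred_eq] at h
    exact ⟨0, hmem .., hmem .., by simp [h], fun w h1 h2 => by simp only at h1 h2; omega⟩

theorem side_mem_wordPartition (k : ℕ) (w : List ℕ) (a : ℕ) : (a, a + 1) ∈ wordPartition k w := by
  cases w with
  | nil => simp [wordPartition_nil]
  | cons i w =>
    rw [wordPartition_cons]
    exact .inl rfl

/-- The new vertices are cut off by `(i, i + k)`, the image of the side `(i, i + 1)`, which cannot
cover the image of a long segment. -/
theorem cell_shift {k i a b : ℕ} (hk : 2 ≤ k) {E : Set (ℕ × ℕ)} (hside : ∀ a, (a, a + 1) ∈ E)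
    (hab : a + 1 < b) :
    {v | shift k (i + 1) a ≤ v ∧ v ≤ shift k (i + 1) b ∧ ∀ c d, (c, d) ∈ extend k i E → c < v →
      v < d → c ≤ shift k (i + 1) a ∧ shift k (i + 1) b ≤ d} =
    shift k (i + 1) ''
      {v | a ≤ v ∧ v ≤ b ∧ ∀ c d, (c, d) ∈ E → c < v → v < d → c ≤ a ∧ b ≤ d} := by
  ext v
  constructor
  · rintro ⟨h1, h2, h3⟩
    rcases shift_cases k (i + 1) v with hv | ⟨v, rfl⟩
    · have h4 := shift_mem_extend (k := k) (i := i) (hside i)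
      obtain ⟨h5, h6⟩ := h3 _ _ h4 (by rw [shift_self]; omega)
        (by rw [shift_succ_self hk]; omega)
      rw [shift_le_iff] at h5 h6
      omega
    · refine ⟨v, ⟨shift_le_iff.1 h1, shift_le_iff.1 h2, fun c d hcd hc hd => ?_⟩, rfl⟩
      have := h3 _ _ (shift_mem_extend hcd) (shift_lt_iff.2 hc) (shift_lt_iff.2 hd)
      rwa [shift_le_iff, shift_le_iff] at this
  · rintro ⟨v, ⟨h1, h2, h3⟩, rfl⟩
    refine ⟨shift_le_iff.2 h1, shift_le_iff.2 h2, fun c d hcd hc hd => ?_⟩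
    rw [mem_extend] at hcd
    rcases hcd with rfl | ⟨c, d, hcd, rfl, rfl⟩
    · omega
    · rw [shift_le_iff, shift_le_iff]
      exact h3 c d hcd (shift_lt_iff.1 hc) (shift_lt_iff.1 hd)

theorem cell_new {k : ℕ} (hk : 2 ≤ k) (i : ℕ) (E : Set (ℕ × ℕ)) :
    {v | i ≤ v ∧ v ≤ i + k ∧ ∀ c d, (c, d) ∈ extend k i E → c < v → v < d →
      c ≤ i ∧ i + k ≤ d} = Finset.Icc i (i + k) := by
  ext v
  simp only [Set.mem_ofPred_eq, Finset.coe_Icc, Set.mem_Icc]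
  refine ⟨fun h => ⟨h.1, h.2.1⟩, fun ⟨h1, h2⟩ => ⟨h1, h2, fun c d hcd hc hd => ?_⟩⟩
  rw [mem_extend] at hcd
  rcases hcd with rfl | ⟨c, d, hcd, rfl, rfl⟩
  · omega
  · have hc' := hc.trans_le h2
    have hd' := h1.trans_lt hd
    unfold shift at *
    split_ifs at * <;> omega

theorem IsPolygonPartition.extend {k : ℕ} (hk : 2 ≤ k) (i : ℕ) {E : Set (ℕ × ℕ)}
    (h : IsPolygonPartition k E) : IsPolygonPartition k (extend k i E) where
  lt a b hab := by
    rw [mem_extend] at hab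
    rcases hab with rfl | ⟨c, d, hcd, rfl, rfl⟩
    · omega
    · exact shift_lt_iff.2 (h.lt c d hcd)
  side a := .inl rfl
  noncrossing a b c d hab hcd := by
    rw [mem_extend] at hab
    rcases hab with rfl | ⟨a, b, hab, rfl, rfl⟩
    · omega
    rw [mem_extend] at hcd
    rcases hcd with rfl | ⟨c, d, hcd, rfl, rfl⟩
    · omega
    simp only [shift_lt_iff]
    exact h.noncrossing a b c d hab hcd
  finite := by
    refine ((h.finite.image (Prod.map (shift k (i + 1)) (shift k (i + 1)))).insert
      (i, i + k)).subset ?_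
    rintro ⟨a, b⟩ ⟨hab, hlt⟩
    rw [mem_extend] at hab
    rcases hab with rfl | ⟨a, b, hab, rfl, rfl⟩
    · simp at hlt
    · by_cases hb : a + 1 < b
      · exact .inr ⟨(a, b), ⟨hab, hb⟩, rfl⟩
      · left
        have := h.lt a b hab
        obtain rfl : b = a + 1 := by omega
        simp only at hlt
        obtain rfl : a = i := by
          unfold shift at hlt
          split_ifs at hlt <;> omega
        rw [shift_self, shift_succ_self hk]
  cell a b hab hlt := by
    rw [mem_extend] at hab
    rcases hab with rfl | ⟨a, b, hab, rfl, rfl⟩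
    · omega
    by_cases hb : a + 1 < b
    · rw [cell_shift hk h.side hb, Set.ncard_image_of_injective _ (shift_strictMono k _).injective]
      exact h.cell a b hab hb
    · have := h.lt a b hab
      obtain rfl : b = a + 1 := by omega
      obtain rfl : a = i := by
        unfold shift at hlt
        split_ifs at hlt <;> omega
      rw [shift_self, shift_succ_self hk, cell_new hk, Set.ncard_coe_finset, Nat.card_Icc]
      omega

theorem isPolygonPartition_of_extend {k i : ℕ} (hk : 2 ≤ k) {E : Set (ℕ × ℕ)}
    (hside : ∀ a, (a, a + 1) ∈ E) (h : IsPolygonPartition k (extend k i E)) :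
    IsPolygonPartition k E where
  lt a b hab := shift_lt_iff.1 (h.lt _ _ (shift_mem_extend hab))
  side := hside
  noncrossing a b c d hab hcd := by
    have := h.noncrossing _ _ _ _ (shift_mem_extend hab) (shift_mem_extend hcd)
    simpa only [shift_lt_iff] using this
  finite := by
    have hs := (shift_strictMono k (i + 1)).injective
    refine (h.finite.preimage ((hs.prodMap hs).injOn)).subset ?_
    rintro ⟨a, b⟩ ⟨hab, hlt⟩
    refine ⟨shift_mem_extend hab, ?_⟩
    simp only [Prod.map] at hlt ⊢
    unfold shift
    split_ifs <;> omega
  cell a b hab hlt := by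
    have := h.cell _ _ (shift_mem_extend hab) (by unfold shift; split_ifs <;> omega)
    rwa [cell_shift hk hside hlt,
      Set.ncard_image_of_injective _ (shift_strictMono k _).injective] at this

/-- The drawn segments that are not sides. -/
def longSegments (E : Set (ℕ × ℕ)) : Set (ℕ × ℕ) := {e ∈ E | e.1 + 1 < e.2}

/-- Take a shortest long segment `(a, b)`. By non-crossing, no other long segment ends strictly
inside it, so its cell contains all of `a, …, b` and `b = a + k`. The inner vertices lie only on
sides and can be removed. -/
theorem IsPolygonPartition.exists_extend {k : ℕ} (hk : 2 ≤ k) {E : Set (ℕ × ℕ)}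
    (h : IsPolygonPartition k E) (hne : (longSegments E).Nonempty) :
    ∃ i E', E = PolygonTamari.extend k i E' ∧ (∀ a, (a, a + 1) ∈ E') ∧ (i, i + k) ∈ E := by
  obtain ⟨⟨a, b⟩, ⟨hab, hlt⟩, hmin⟩ :=
    Set.exists_min_image (longSegments E) (fun e => e.2 - e.1) h.finite hne
  simp only at hlt
  have hmin' : ∀ c d, (c, d) ∈ E → c + 1 < d → b - a ≤ d - c :=
    fun c d hcd hlt' => hmin (c, d) ⟨hcd, hlt'⟩
  have hcell := h.cell a b hab hlt
  have hIcc : {v | a ≤ v ∧ v ≤ b ∧ ∀ c d, (c, d) ∈ E → c < v → v < d → c ≤ a ∧ b ≤ d} =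
      Finset.Icc a b := by
    ext v
    simp only [Set.mem_ofPred_eq, Finset.coe_Icc, Set.mem_Icc]
    refine ⟨fun h => ⟨h.1, h.2.1⟩, fun ⟨h1, h2⟩ => ⟨h1, h2, fun c d hcd hc hd => ?_⟩⟩
    have := h.noncrossing a b c d hab hcd
    have := h.noncrossing c d a b hcd hab
    have := hmin' c d hcd (by omega)
    omega
  rw [hIcc, Set.ncard_coe_finset, Nat.card_Icc] at hcell
  obtain rfl : b = a + k := by omega
  have hout : ∀ c d, (c, d) ∈ E → c + 1 < d →
      (∃ c', c = shift k (a + 1) c') ∧ ∃ d', d = shift k (a + 1) d' := fun c d hcd hlt' => by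
    have h1 := h.noncrossing a _ c d hab hcd
    have h2 := h.noncrossing c d a _ hcd hab
    have h3 := hmin' c d hcd hlt'
    exact ⟨(shift_cases k (a + 1) c).resolve_left fun _ => by omega,
      (shift_cases k (a + 1) d).resolve_left fun _ => by omega⟩
  refine ⟨a, {e | (shift k (a + 1) e.1, shift k (a + 1) e.2) ∈ E}, ?_, fun c => ?_, hab⟩
  · ext ⟨c, d⟩
    rw [mem_extend]
    constructor
    · intro hcd
      have := h.lt c d hcd
      by_cases hd : c + 1 < d
      · obtain ⟨⟨c, rfl⟩, ⟨d, rfl⟩⟩ := hout c d hcd hd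
        exact .inr ⟨c, d, hcd, rfl, rfl⟩
      · left
        omega
    · rintro (rfl | ⟨c, d, hcd, rfl, rfl⟩)
      · exact h.side c
      · exact hcd
  · simp only [Set.mem_ofPred_eq]
    rcases eq_or_ne c a with rfl | hc
    · rwa [shift_self, shift_succ_self hk]
    · have : shift k (a + 1) (c + 1) = shift k (a + 1) c + 1 := by
        unfold shift
        split_ifs <;> omega
      rw [this]
      exact h.side _

/-- Long segments stay long, and `(i, i + k)` comes from a side. This makes the repeated removal of
polygons terminate. -/
theorem longSegments_lt {k i : ℕ} (hk : 2 ≤ k) {E : Set (ℕ × ℕ)}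
    (h : IsPolygonPartition k (extend k i E)) (hi : (i, i + k) ∈ extend k i E) :
    (longSegments E).ncard < (longSegments (extend k i E)).ncard := by
  have hs := (shift_strictMono k (i + 1)).injective
  rw [← Set.ncard_image_of_injective _ (hs.prodMap hs)]
  refine Set.ncard_lt_ncard ((Set.ssubset_iff_of_subset ?_).2 ⟨(i, i + k), ⟨hi, ?_⟩, ?_⟩) h.finite
  · rintro _ ⟨⟨a, b⟩, ⟨hab, hlt⟩, rfl⟩
    refine ⟨shift_mem_extend hab, ?_⟩
    simp only [Prod.map] at hlt ⊢
    unfold shift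
    split_ifs <;> omega
  · simp only
    omega
  · rintro ⟨⟨a, b⟩, ⟨-, hlt⟩, heq⟩
    simp only [Prod.map, Prod.mk.injEq] at heq hlt
    obtain ⟨h1, h2⟩ := heq
    rw [shift_inj.1 (h1.trans (shift_self k i).symm),
      shift_inj.1 (h2.trans (shift_succ_self hk i).symm)] at hlt
    omega

theorem isPolygonPartition_wordPartition {k : ℕ} (hk : 2 ≤ k) (w : List ℕ) :
    IsPolygonPartition k (wordPartition k w) := by
  induction w with
  | nil =>
    have hmem : ∀ a b, (a, b) ∈ wordPartition k [] ↔ b = a + 1 := fun a b => by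
      rw [wordPartition_nil]
      rfl
    refine ⟨fun a b h => ?_, side_mem_wordPartition k [], fun a b c d h1 h2 => ?_, ?_,
      fun a b h hlt => ?_⟩
    · rw [hmem] at h
      omega
    · rw [hmem] at h1
      omega
    · convert Set.finite_empty (α := ℕ × ℕ)
      rw [Set.eq_empty_iff_forall_notMem]
      rintro ⟨a, b⟩ ⟨h, hlt⟩
      rw [hmem] at h
      simp only at hlt
      omega
    · rw [hmem] at h
      omega
  | cons i w ih =>
    rw [wordPartition_cons]
    exact ih.extend hk i

theorem IsPolygonPartition.exists_wordPartition {k : ℕ} (hk : 2 ≤ k) {E : Set (ℕ × ℕ)}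
    (h : IsPolygonPartition k E) : ∃ w, wordPartition k w = E := by
  induction hn : (longSegments E).ncard using Nat.strong_induction_on generalizing E with
  | _ n ih =>
    subst hn
    rcases (longSegments E).eq_empty_or_nonempty with hE | hE
    · refine ⟨[], ?_⟩
      rw [wordPartition_nil]
      ext ⟨a, b⟩
      constructor
      · intro hab
        simp only [Set.mem_ofPred_eq] at hab
        exact hab ▸ h.side a
      · intro hab
        by_contra hne
        have := h.lt a b hab
        simp only [Set.mem_ofPred_eq] at hne
        exact Set.eq_empty_iff_forall_notMem.1 hE (a, b) ⟨hab, by simp only; omega⟩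
    · obtain ⟨i, E', rfl, hside, hi⟩ := h.exists_extend hk hE
      obtain ⟨w, rfl⟩ := ih _ (longSegments_lt hk h hi)
        (isPolygonPartition_of_extend hk hside h) rfl
      exact ⟨i :: w, wordPartition_cons ..⟩

theorem range_polygonPartition {k : ℕ} (hk : 2 ≤ k) :
    Set.range (fun u => polygonPartition (starSequence k u)) = {E | IsPolygonPartition k E} := by
  ext E
  constructor
  · rintro ⟨u, rfl⟩
    exact isPolygonPartition_wordPartition hk u.toList
  · intro h
    obtain ⟨w, hw⟩ := h.exists_wordPartition hk
    exact ⟨FreeMonoid.ofList w, hw⟩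

/-! ### The polygon partition determines top words and bottom words -/

/-- Gluings to two different sides commute. For old segments this is `shift_shift`; a side drawn at
the inner stage stays a side, except for the one that the outer polygon is glued to. -/
theorem extend_extend {k i j : ℕ} (hk : 2 ≤ k) (h : i < j) {E : Set (ℕ × ℕ)}
    (hE : ∀ a, (a, a + 1) ∈ E) :
    extend k i (extend k j E) = extend k (j + (k - 1)) (extend k i E) := by
  have hadd : j + (k - 1) + 1 = j + 1 + (k - 1) := by omega
  ext ⟨a, b⟩
  simp only [mem_extend]
  constructor
  · rintro (rfl | ⟨c, d, rfl | ⟨c, d, hcd, rfl, rfl⟩, rfl, rfl⟩)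
    · exact .inl rfl
    · rcases eq_or_ne c i with rfl | hc
      · refine .inr ⟨shift k (c + 1) c, shift k (c + 1) (c + 1), .inr ⟨_, _, hE c, rfl, rfl⟩, ?_⟩
        rw [shift_self, shift_succ_self hk]
        unfold shift
        constructor <;> split_ifs <;> omega
      · left
        unfold shift
        split_ifs <;> omega
    · refine .inr ⟨shift k (i + 1) c, shift k (i + 1) d, .inr ⟨c, d, hcd, rfl, rfl⟩, ?_⟩
      rw [hadd]
      exact ⟨shift_shift (by omega) c, shift_shift (by omega) d⟩
  · rintro (rfl | ⟨c, d, rfl | ⟨c, d, hcd, rfl, rfl⟩, rfl, rfl⟩)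
    · exact .inl rfl
    · rcases eq_or_ne c (j + (k - 1)) with rfl | hc
      · refine .inr ⟨shift k (j + 1) j, shift k (j + 1) (j + 1), .inr ⟨_, _, hE j, rfl, rfl⟩, ?_⟩
        unfold shift
        constructor <;> split_ifs <;> omega
      · left
        unfold shift
        split_ifs <;> omega
    · refine .inr ⟨shift k (j + 1) c, shift k (j + 1) d, .inr ⟨c, d, hcd, rfl, rfl⟩, ?_⟩
      rw [hadd]
      exact ⟨(shift_shift (by omega) c).symm, (shift_shift (by omega) d).symm⟩

theorem Swap.wordPartition_eq {k : ℕ} (hk : 2 ≤ k) {v w : List ℕ} (h : Swap k v w) :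
    wordPartition k v = wordPartition k w := by
  induction h with
  | head i j w h =>
    simp only [wordPartition_cons]
    exact extend_extend hk h (side_mem_wordPartition k w)
  | cons i _ ih => rw [wordPartition_cons, wordPartition_cons, ih]

theorem new_mem_wordPartition {k : ℕ} (hk : 2 ≤ k) (i : ℕ) (w : List ℕ) :
    (i, i + k) ∈ wordPartition k (i :: w) := by
  rw [wordPartition_cons]
  have := shift_mem_extend (k := k) (i := i) (side_mem_wordPartition k w i)
  rwa [shift_self, shift_succ_self hk] at this

theorem wordPartition_cons_injective {k i : ℕ} {v w : List ℕ}
    (h : wordPartition k (i :: v) = wordPartition k (i :: w)) :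
    wordPartition k v = wordPartition k w := by
  ext ⟨a, b⟩
  rw [← shift_mem_extend_iff (k := k) (i := i) (side_mem_wordPartition k v),
    ← shift_mem_extend_iff (k := k) (i := i) (side_mem_wordPartition k w),
    ← wordPartition_cons, h, wordPartition_cons]

theorem nil_ne_cons {k : ℕ} (hk : 2 ≤ k) (i : ℕ) (w : List ℕ) :
    wordPartition k [] ≠ wordPartition k (i :: w) := by
  intro h
  have := new_mem_wordPartition hk i w
  rw [← h, wordPartition_nil] at this
  simp only [Set.mem_ofPred_eq] at this
  omega

/-- A class of words is determined by its polygon partition, if the latter determines the first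
letter. -/
theorem wordPartition_injOn {k : ℕ} (hk : 2 ≤ k) {P : List ℕ → Prop}
    (htail : ∀ i w, P (i :: w) → P w)
    (hhead : ∀ i j v w, P (i :: v) → P (j :: w) →
      wordPartition k (i :: v) = wordPartition k (j :: w) → i ≤ j)
    {v w : List ℕ} (hv : P v) (hw : P w) (h : wordPartition k v = wordPartition k w) : v = w := by
  induction v generalizing w with
  | nil =>
    cases w with
    | nil => rfl
    | cons j w => exact (nil_ne_cons hk j w h).elim
  | cons i v ih =>
    cases w with
    | nil => exact (nil_ne_cons hk i v h.symm).elim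
    | cons j w =>
      obtain rfl : i = j := le_antisymm (hhead i j v w hv hw h) (hhead j i w v hw hv h.symm)
      rw [ih (htail i v hv) (htail i w hw) (wordPartition_cons_injective h)]

/-- Earlier long segments have left endpoints at most `j ≤ i`, which the shift fixes; the only other
long segment is `(i, i + k)`. So `i` is the largest left endpoint. -/
theorem fst_le_of_top {k i a b : ℕ} {w : List ℕ} (hw : IsTop (i :: w))
    (hab : (a, b) ∈ wordPartition k (i :: w)) (hlt : a + 1 < b) : a ≤ i := by
  induction w generalizing i a b with
  | nil =>
    rw [wordPartition_cons, wordPartition_nil] at hab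
    rw [mem_extend] at hab
    rcases hab with rfl | ⟨a, b, hab, rfl, rfl⟩
    · omega
    · simp only [Set.mem_ofPred_eq] at hab
      unfold shift at *
      split_ifs at * <;> omega
  | cons j w ih =>
    obtain ⟨hj, hw⟩ := List.pairwise_cons.1 hw
    have hj := hj j (by simp)
    rw [wordPartition_cons] at hab
    rw [mem_extend] at hab
    rcases hab with rfl | ⟨a, b, hab, rfl, rfl⟩
    · omega
    by_cases hb : a + 1 < b
    · have := ih hw hab hb
      unfold shift
      split_ifs <;> omega
    · unfold shift at *
      split_ifs at * <;> omega

/-- Earlier right endpoints are at least `j + k ≥ i + 1`, so the shift moves them to at least `i +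
k`. -/
theorem le_snd_of_bottom {k i a b : ℕ} (hk : 2 ≤ k) {w : List ℕ} (hw : IsBottom k (i :: w))
    (hab : (a, b) ∈ wordPartition k (i :: w)) (hlt : a + 1 < b) : i + k ≤ b := by
  induction w generalizing i a b with
  | nil =>
    rw [wordPartition_cons, wordPartition_nil] at hab
    rw [mem_extend] at hab
    rcases hab with rfl | ⟨a, b, hab, rfl, rfl⟩
    · omega
    · simp only [Set.mem_ofPred_eq] at hab
      unfold shift at *
      split_ifs at * <;> omega
  | cons j w ih =>
    obtain ⟨hj, hw⟩ := List.isChain_cons_cons.1 hw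
    rw [wordPartition_cons] at hab
    rw [mem_extend] at hab
    rcases hab with rfl | ⟨a, b, hab, rfl, rfl⟩
    · omega
    by_cases hb : a + 1 < b
    · have := ih hw hab hb
      unfold shift
      split_ifs <;> omega
    · have := (isPolygonPartition_wordPartition hk (j :: w)).lt a b hab
      unfold shift at *
      split_ifs at * <;> omega

theorem eq_of_top {k : ℕ} (hk : 2 ≤ k) {v w : List ℕ} (hv : IsTop v) (hw : IsTop w)
    (h : wordPartition k v = wordPartition k w) : v = w :=
  wordPartition_injOn hk (fun _ _ h => h.tail)
    (fun i _ _ _ _ hw h =>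
      fst_le_of_top hw (h ▸ new_mem_wordPartition hk i _) (by omega)) hv hw h

theorem eq_of_bottom {k : ℕ} (hk : 2 ≤ k) {v w : List ℕ} (hv : IsBottom k v)
    (hw : IsBottom k w) (h : wordPartition k v = wordPartition k w) : v = w :=
  wordPartition_injOn hk (fun _ _ h => h.tail)
    (fun i j _ _ hv _ h => by
      have := le_snd_of_bottom hk hv (h ▸ new_mem_wordPartition hk j _) (by omega)
      omega) hv hw h

/-! ### Forests -/

theorem addCaret_of_lt {k : ℕ} {α : Type} {l : α} {i p : ℕ} {f : Forest k α} (h : p < i) :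
    addCaret l i f p = f p := by simp [addCaret, h]

theorem addCaret_self {k : ℕ} {α : Type} {l : α} {i : ℕ} {f : Forest k α} :
    addCaret l i f i = .node l fun c => f (i + c) := by simp [addCaret]

theorem addCaret_of_gt {k : ℕ} {α : Type} {l : α} {i p : ℕ} {f : Forest k α} (h : i < p) :
    addCaret l i f p = f (p + (k - 1)) := by simp [addCaret, h.not_gt, h.ne']

theorem addCaret_inj {k : ℕ} (hk : 2 ≤ k) {α : Type} {l : α} {i : ℕ} {f g : Forest k α}
    (h : addCaret l i f = addCaret l i g) : f = g := by
  funext p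
  by_cases h1 : p < i
  · have := congrFun h p
    rwa [addCaret_of_lt h1, addCaret_of_lt h1] at this
  by_cases h2 : p < i + k
  · have := congrFun h i
    rw [addCaret_self, addCaret_self, KTree.node.injEq] at this
    have := congrFun this.2 ⟨p - i, by omega⟩
    simpa [Nat.add_sub_cancel' (not_lt.1 h1)] using this
  · have := congrFun h (p - (k - 1))
    rwa [addCaret_of_gt (by omega), addCaret_of_gt (by omega),
      Nat.sub_add_cancel (by omega)] at this

/-- The caret at `i` merges `k` roots into one, so root `j` after it is root `j + (k - 1)` before
it, and the two carets are disjoint. -/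
theorem addCaret_comm {k : ℕ} (hk : 2 ≤ k) {α : Type} {l l' : α} {i j : ℕ} (h : i < j)
    (f : Forest k α) :
    addCaret l' j (addCaret l i f) = addCaret l i (addCaret l' (j + (k - 1)) f) := by
  funext p
  rcases lt_trichotomy p i with hp | rfl | hp
  · rw [addCaret_of_lt (hp.trans h), addCaret_of_lt hp, addCaret_of_lt hp,
      addCaret_of_lt (by omega)]
  · rw [addCaret_of_lt h, addCaret_self, addCaret_self]
    congr 1
    funext c
    rw [addCaret_of_lt (by omega)]
  rw [addCaret_of_gt (f := addCaret l' _ f) hp]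
  rcases lt_trichotomy p j with hpj | rfl | hpj
  · rw [addCaret_of_lt hpj, addCaret_of_gt hp, addCaret_of_lt (by omega)]
  · rw [addCaret_self, addCaret_self]
    congr 1
    funext c
    rw [addCaret_of_gt (by omega)]
    congr 1
    omega
  · rw [addCaret_of_gt hpj, addCaret_of_gt (by omega), addCaret_of_gt (by omega)]

/-- The forest of a word without labels. -/
def shape (k : ℕ) (w : List ℕ) (f : Forest k Unit) : Forest k Unit :=
  w.foldl (fun f i => addCaret () i f) f

theorem delinearize_addCaret {k : ℕ} (l i : ℕ) (f : Forest k ℕ) :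
    delinearize (addCaret l i f) = addCaret () i (delinearize f) := by
  funext p
  simp only [delinearize, addCaret]
  split_ifs <;> rfl

theorem delinearize_addCarets {k : ℕ} (j : ℕ) (w : List ℕ) (f : Forest k ℕ) :
    delinearize (addCarets j w f) = shape k w (delinearize f) := by
  induction w generalizing j f with
  | nil => rfl
  | cons i w ih => rw [addCarets, ih, delinearize_addCaret, shape, shape, List.foldl_cons]

theorem tamariEquiv_iff {k : ℕ} {u v : FreeMonoid ℕ} : TamariEquiv k u v ↔
    shape k u.toList (fun _ => .leaf) = shape k v.toList (fun _ => .leaf) := by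
  unfold TamariEquiv linearizedForest
  rw [delinearize_addCarets, delinearize_addCarets]
  rfl

theorem Swap.shape_eq {k : ℕ} (hk : 2 ≤ k) {v w : List ℕ} (h : Swap k v w) (f : Forest k Unit) :
    shape k v f = shape k w f := by
  induction h generalizing f with
  | head i j w h =>
    simp only [shape, List.foldl_cons]
    rw [addCaret_comm hk h]
  | cons i _ ih => exact ih _

theorem shape_concat (k : ℕ) (w : List ℕ) (i : ℕ) (f : Forest k Unit) :
    shape k (w ++ [i]) f = addCaret () i (shape k w f) := by
  simp [shape]

theorem shape_eq_leaf {k i p : ℕ} {w : List ℕ} (hw : ∀ x ∈ w, i ≤ x) (hp : p < i) :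
    shape k w (fun _ => .leaf) p = .leaf := by
  induction w using List.reverseRecOn with
  | nil => rfl
  | append_singleton w j ih =>
    have := hw j (by simp)
    rw [shape_concat, addCaret_of_lt (by omega), ih fun x hx => hw x (by simp [hx])]

theorem shape_concat_ne (k : ℕ) (w : List ℕ) (i : ℕ) :
    shape k (w ++ [i]) (fun _ => .leaf) i ≠ .leaf := by
  rw [shape_concat, addCaret_self]
  simp

/-- The last letter of a top word is its smallest one, hence the index of the leftmost non-trivial
tree; `addCaret_inj` then removes its caret. -/
theorem eq_of_shape_eq {k : ℕ} (hk : 2 ≤ k) {v w : List ℕ} (hv : IsTop v) (hw : IsTop w)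
    (h : shape k v (fun _ => .leaf) = shape k w (fun _ => .leaf)) : v = w := by
  have hle : ∀ {i j : ℕ} {v w : List ℕ}, IsTop (v ++ [i]) →
      shape k (v ++ [i]) (fun _ => .leaf) = shape k (w ++ [j]) (fun _ => .leaf) → i ≤ j := by
    intro i j v w hv h
    by_contra hlt
    refine shape_concat_ne k w j ?_
    rw [← h]
    refine shape_eq_leaf (i := i) (fun x hx => ?_) (not_le.1 hlt)
    rcases List.mem_append.1 hx with hx | hx
    · exact (List.pairwise_append.1 hv).2.2 x hx i (by simp)
    · simp only [List.mem_singleton] at hx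
      exact hx.ge
  induction v using List.reverseRecOn generalizing w with
  | nil =>
    rcases List.eq_nil_or_concat' w with rfl | ⟨w, j, rfl⟩
    · rfl
    · exact (shape_concat_ne k w j (congrFun h j).symm).elim
  | append_singleton v i ih =>
    rcases List.eq_nil_or_concat' w with rfl | ⟨w, j, rfl⟩
    · exact (shape_concat_ne k v i (congrFun h i)).elim
    · obtain rfl : i = j := le_antisymm (hle hv h) (hle hw h.symm)
      rw [shape_concat, shape_concat] at h
      rw [ih (List.pairwise_append.1 hv).1 (List.pairwise_append.1 hw).1 (addCaret_inj hk h)]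

/-! ### Linearized forests -/

/-- Linearized forests with `n` carets. -/
structure IsLinearizedOfSize (k n : ℕ) (f : Forest k ℕ) : Prop where
  finite : ∃ N, ∀ p, N ≤ p → f p = .leaf
  decreasing : ∀ i, (f i).Decreasing
  count : ∀ j, ∑ᶠ i, (f i).count j = if 1 ≤ j ∧ j ≤ n then 1 else 0

theorem isLinearizedForest_iff {k : ℕ} {f : Forest k ℕ} :
    IsLinearizedForest k f ↔ ∃ n, IsLinearizedOfSize k n f := by
  have hfin : {i | f i ≠ .leaf}.Finite ↔ ∃ N, ∀ p, N ≤ p → f p = .leaf := by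
    constructor
    · intro h
      obtain ⟨N, hN⟩ := h.bddAbove
      refine ⟨N + 1, fun p hp => ?_⟩
      by_contra hne
      have : p ≤ N := hN hne
      omega
    · rintro ⟨N, hN⟩
      refine (Set.finite_lt_nat N).subset fun p hp => ?_
      by_contra hlt
      exact hp (hN p (not_lt.1 hlt))
  constructor
  · rintro ⟨h1, h2, n, h3⟩
    exact ⟨n, hfin.1 h1, h2, h3⟩
  · rintro ⟨n, h1, h2, h3⟩
    exact ⟨hfin.2 h1, h2, n, h3⟩

theorem finsum_count_eq {k : ℕ} {f : Forest k ℕ} {N : ℕ} (h : ∀ p, N ≤ p → f p = .leaf) (j : ℕ) :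
    ∑ᶠ i, (f i).count j = ∑ i ∈ Finset.range N, (f i).count j := by
  refine finsum_eq_sum_of_support_subset _ fun p hp => ?_
  simp only [Finset.coe_range, Set.mem_Iio]
  by_contra hlt
  rw [Function.mem_support, h p (not_lt.1 hlt)] at hp
  exact hp rfl

theorem addCaret_eq_leaf {k l i N : ℕ} {f : Forest k ℕ} (h : ∀ p, N ≤ p → f p = .leaf) (p : ℕ)
    (hp : N + i + 1 ≤ p) : addCaret l i f p = .leaf := by
  rw [addCaret_of_gt (by omega), h _ (by omega)]

theorem finsum_count_addCaret {k l i N : ℕ} (hk : 2 ≤ k) {f : Forest k ℕ}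
    (h : ∀ p, N ≤ p → f p = .leaf) (j : ℕ) :
    ∑ᶠ p, (addCaret l i f p).count j = (if l = j then 1 else 0) + ∑ᶠ p, (f p).count j := by
  -- The bounds are chosen so that the ranges split as `i + 1 + N` and `i + (k + N)`: the new tree
  -- corresponds to the `k` old ones.
  have h' : ∀ p, i + 1 + N ≤ p → addCaret l i f p = .leaf := fun p hp =>
    addCaret_eq_leaf h p (by omega)
  have hN : ∀ p, i + (k + N) ≤ p → f p = .leaf := fun p hp => h p (by omega)
  rw [finsum_count_eq h', finsum_count_eq hN, Finset.sum_range_add _ (i + 1),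
    Finset.sum_range_succ, Finset.sum_range_add _ i, Finset.sum_range_add _ k,
    addCaret_self, KTree.count, Fin.sum_univ_eq_sum_range (fun c => (f (i + c)).count j)]
  have e1 : ∑ p ∈ Finset.range i, (addCaret l i f p).count j =
      ∑ p ∈ Finset.range i, (f p).count j :=
    Finset.sum_congr rfl fun p hp => by rw [addCaret_of_lt (Finset.mem_range.1 hp)]
  have e2 : ∑ p ∈ Finset.range N, (addCaret l i f (i + 1 + p)).count j =
      ∑ p ∈ Finset.range N, (f (i + (k + p))).count j :=
    Finset.sum_congr rfl fun p hp => by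
      rw [addCaret_of_gt (by omega)]
      congr 2
      omega
  rw [e1, e2]
  ring

theorem IsLinearizedOfSize.le_of_count_ne_zero {k n : ℕ} {f : Forest k ℕ}
    (h : IsLinearizedOfSize k n f) {i j : ℕ} (hj : (f i).count j ≠ 0) : 1 ≤ j ∧ j ≤ n := by
  obtain ⟨N, hN⟩ := h.finite
  have h1 := h.count j
  rw [finsum_count_eq (N := N + i + 1) fun p hp => hN p (by omega)] at h1
  have h2 : (f i).count j ≤ ∑ i ∈ Finset.range (N + i + 1), (f i).count j :=
    Finset.single_le_sum (f := fun i => (f i).count j) (fun _ _ => Nat.zero_le _) (by simp)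
  by_contra hne
  rw [if_neg hne] at h1
  omega

theorem count_label_ne_zero {k l : ℕ} {c : Fin k → KTree k ℕ} : (KTree.node l c).count l ≠ 0 := by
  simp [KTree.count]

theorem IsLinearizedOfSize.addCaret {k n : ℕ} (hk : 2 ≤ k) {f : Forest k ℕ}
    (h : IsLinearizedOfSize k n f) (i : ℕ) :
    IsLinearizedOfSize k (n + 1) (addCaret (n + 1) i f) := by
  obtain ⟨N, hN⟩ := h.finite
  refine ⟨⟨_, addCaret_eq_leaf hN⟩, fun p => ?_, fun j => ?_⟩
  · rcases lt_trichotomy p i with hp | rfl | hp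
    · rw [addCaret_of_lt hp]
      exact h.decreasing p
    · rw [addCaret_self]
      refine fun c => ⟨?_, h.decreasing _⟩
      change (f (p + c)).RootBelow (n + 1)
      cases hc : f (p + c) with
      | leaf => trivial
      | node l d =>
        have := h.le_of_count_ne_zero (i := p + c) (j := l) (by rw [hc]; exact count_label_ne_zero)
        exact Nat.lt_succ_of_le this.2
    · rw [addCaret_of_gt hp]
      exact h.decreasing _
  · rw [finsum_count_addCaret hk hN, h.count]
    split_ifs <;> omega

theorem IsLinearizedOfSize.of_addCaret {k n i : ℕ} (hk : 2 ≤ k) {f : Forest k ℕ}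
    (h : IsLinearizedOfSize k (n + 1) (PolygonTamari.addCaret (n + 1) i f)) :
    IsLinearizedOfSize k n f := by
  obtain ⟨N, hN⟩ := h.finite
  have hf : ∀ p, N + i + k ≤ p → f p = .leaf := fun p hp => by
    have := hN (p - (k - 1)) (by omega)
    rwa [addCaret_of_gt (by omega), Nat.sub_add_cancel (by omega)] at this
  refine ⟨⟨_, hf⟩, fun p => ?_, fun j => ?_⟩
  · by_cases h1 : p < i
    · simpa [addCaret_of_lt h1] using h.decreasing p
    by_cases h2 : p < i + k
    · have := h.decreasing i
      rw [addCaret_self] at this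
      simpa [Nat.add_sub_cancel' (not_lt.1 h1)] using (this ⟨p - i, by omega⟩).2
    · have := h.decreasing (p - (k - 1))
      rwa [addCaret_of_gt (by omega), Nat.sub_add_cancel (by omega)] at this
  · have := h.count j
    rw [finsum_count_addCaret hk hf] at this
    split_ifs at this ⊢ <;> omega

theorem KTree.Decreasing.exists_node {k : ℕ} {t : KTree k ℕ} (ht : t.Decreasing) {j : ℕ}
    (hj : t.count j ≠ 0) : ∃ l c, t = .node l c ∧ j ≤ l := by
  induction t with
  | leaf => exact (hj rfl).elim
  | node l c ih =>
    refine ⟨l, c, rfl, ?_⟩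
    by_cases hl : l = j
    · exact hl.ge
    · rw [KTree.count, if_neg hl, zero_add] at hj
      obtain ⟨i, -, hi⟩ := Finset.exists_ne_zero_of_sum_ne_zero hj
      obtain ⟨l', c', hc, hjl⟩ := ih i (ht i).2 hi
      have := (ht i).1
      rw [hc] at this
      exact hjl.trans (Nat.le_of_lt this)

/-- The largest label of a decreasing tree is at its root, so the caret `n + 1` is the root of some
tree. Deleting it turns its `k` children into roots. -/
theorem IsLinearizedOfSize.exists_addCaret {k n : ℕ} (hk : 2 ≤ k) {f : Forest k ℕ}
    (h : IsLinearizedOfSize k (n + 1) f) :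
    ∃ i g, f = PolygonTamari.addCaret (n + 1) i g ∧ IsLinearizedOfSize k n g := by
  obtain ⟨i, hi⟩ : ∃ i, (f i).count (n + 1) ≠ 0 := by
    by_contra! hne
    have := h.count (n + 1)
    simp [hne] at this
  obtain ⟨l, c, hl, hle⟩ := (h.decreasing i).exists_node hi
  have h2 := (h.le_of_count_ne_zero (i := i) (j := l) (by rw [hl]; exact count_label_ne_zero)).2
  obtain rfl : l = n + 1 := le_antisymm h2 hle
  have hf : f = PolygonTamari.addCaret (n + 1) i fun p =>
      if p < i then f p else if hp : p - i < k then c ⟨p - i, hp⟩ else f (p - (k - 1)) := by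
    funext p
    rcases lt_trichotomy p i with hp | rfl | hp
    · simp [addCaret_of_lt hp, hp]
    · simp [addCaret_self, hl]
    · rw [addCaret_of_gt hp, if_neg (by omega), dif_neg (by omega), Nat.add_sub_cancel]
  exact ⟨i, _, hf, .of_addCaret hk (hf ▸ h)⟩

theorem addCarets_concat {k : ℕ} (j : ℕ) (w : List ℕ) (i : ℕ) (f : Forest k ℕ) :
    addCarets j (w ++ [i]) f = addCaret (j + w.length) i (addCarets j w f) := by
  induction w generalizing j f with
  | nil => rfl
  | cons a w ih =>
    rw [List.cons_append, addCarets, ih, addCarets, List.length_cons]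
    congr 1
    omega

/-- The linearized forest of a word, as a function on lists. -/
abbrev listForest (k : ℕ) (w : List ℕ) : Forest k ℕ := addCarets 1 w fun _ => .leaf

theorem listForest_concat (k : ℕ) (w : List ℕ) (i : ℕ) :
    listForest k (w ++ [i]) = addCaret (w.length + 1) i (listForest k w) := by
  rw [listForest, addCarets_concat, add_comm]

theorem isLinearizedOfSize_listForest {k : ℕ} (hk : 2 ≤ k) (w : List ℕ) :
    IsLinearizedOfSize k w.length (listForest k w) := by
  induction w using List.reverseRecOn with
  | nil =>
    refine ⟨⟨0, fun _ _ => rfl⟩, fun _ => trivial, fun j => ?_⟩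
    simp only [listForest, addCarets, KTree.count, finsum_zero, List.length_nil]
    rw [if_neg (by omega)]
  | append_singleton w i ih =>
    rw [listForest_concat, List.length_append]
    exact ih.addCaret hk i

theorem IsLinearizedOfSize.exists_listForest {k n : ℕ} (hk : 2 ≤ k) {f : Forest k ℕ}
    (h : IsLinearizedOfSize k n f) : ∃ w, w.length = n ∧ listForest k w = f := by
  induction n generalizing f with
  | zero =>
    refine ⟨[], rfl, funext fun p => ?_⟩
    cases hp : f p with
    | leaf => rfl
    | node l c =>
      have := h.le_of_count_ne_zero (i := p) (j := l) (by rw [hp]; exact count_label_ne_zero)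
      omega
  | succ n ih =>
    obtain ⟨i, g, rfl, hg⟩ := h.exists_addCaret hk
    obtain ⟨w, rfl, rfl⟩ := ih hg
    exact ⟨w ++ [i], by simp, listForest_concat k w i⟩

theorem IsLinearizedOfSize.size_le {k n n' : ℕ} {f : Forest k ℕ} (h : IsLinearizedOfSize k n f)
    (h' : IsLinearizedOfSize k n' f) : n ≤ n' := by
  have h1 := h.count n
  rw [h'.count n] at h1
  split_ifs at h1 <;> omega

/-- The label `n + 1` does not occur in `g`, so on the right it lies only in tree `j`, while on the
left it is at root `i`. -/
theorem IsLinearizedOfSize.root_eq {k n i j : ℕ} {f g : Forest k ℕ}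
    (hg : IsLinearizedOfSize k n g)
    (h : PolygonTamari.addCaret (n + 1) i f = PolygonTamari.addCaret (n + 1) j g) : i = j := by
  have hi := congrFun h i
  rw [addCaret_self] at hi
  have hcount : ∀ p, (g p).count (n + 1) = 0 := fun p => by
    by_contra hne
    have := (hg.le_of_count_ne_zero hne).2
    omega
  rcases lt_trichotomy i j with hij | hij | hij
  · rw [addCaret_of_lt hij] at hi
    exact (count_label_ne_zero (hi ▸ hcount i)).elim
  · exact hij
  · rw [addCaret_of_gt hij] at hi
    exact (count_label_ne_zero (hi ▸ hcount _)).elim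

theorem listForest_injective {k : ℕ} (hk : 2 ≤ k) : Function.Injective (listForest k) := by
  intro v w h
  have hv := isLinearizedOfSize_listForest hk v
  have hw := isLinearizedOfSize_listForest hk w
  have hlen : v.length = w.length :=
    le_antisymm (hv.size_le (h ▸ hw)) (hw.size_le (h ▸ hv))
  clear hv hw
  induction v using List.reverseRecOn generalizing w with
  | nil => exact (List.length_eq_zero_iff.1 hlen.symm).symm
  | append_singleton v i ih =>
    rcases List.eq_nil_or_concat' w with rfl | ⟨w, j, rfl⟩
    · simp at hlen
    · have hlen' : v.length = w.length := by simpa using hlen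
      rw [listForest_concat, listForest_concat, hlen'] at h
      obtain rfl := (isLinearizedOfSize_listForest hk w).root_eq h
      rw [ih (addCaret_inj hk h) hlen']

theorem bijOn_linearizedForest {k : ℕ} (hk : 2 ≤ k) :
    Set.BijOn (linearizedForest k) Set.univ {f | IsLinearizedForest k f} := by
  refine ⟨fun u _ => isLinearizedForest_iff.2 ⟨_, isLinearizedOfSize_listForest hk u.toList⟩,
    fun u _ v _ h => FreeMonoid.toList.injective (listForest_injective hk h), fun f hf => ?_⟩
  obtain ⟨n, hn⟩ := isLinearizedForest_iff.1 hf
  obtain ⟨w, -, hw⟩ := hn.exists_listForest hk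
  exact ⟨FreeMonoid.ofList w, trivial, hw⟩

/-! ### The three descriptions of the equivalence -/

/-- Both words are congruent to top words with the same value of `F`, and these are equal. The lemma
serves for forests and for partitions alike. -/
theorem conGen_of_eq {k : ℕ} {β : Type} (F : List ℕ → β) (hF : ∀ v w, Swap k v w → F v = F w)
    (hinj : ∀ v w, IsTop v → IsTop w → F v = F w → v = w) {u v : FreeMonoid ℕ}
    (h : F u.toList = F v.toList) : conGen (ThompsonRel k) u v := by
  obtain ⟨s, hus, hs⟩ := exists_top k u.toList
  obtain ⟨t, hvt, ht⟩ := exists_top k v.toList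
  have hus := conGen_of_reflTransGen hus
  have hvt := conGen_of_reflTransGen hvt
  obtain rfl : s = t := hinj s t hs ht <|
    (eq_of_conGen F hF hus).symm.trans (h.trans (eq_of_conGen F hF hvt))
  exact (conGen (ThompsonRel k)).trans hus ((conGen (ThompsonRel k)).symm hvt)

theorem conGen_iff_tamariEquiv {k : ℕ} (hk : 2 ≤ k) {u v : FreeMonoid ℕ} :
    conGen (ThompsonRel k) u v ↔ TamariEquiv k u v := by
  rw [tamariEquiv_iff]
  exact ⟨eq_of_conGen (fun w => shape k w fun _ => .leaf) fun _ _ h => h.shape_eq hk _,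
    conGen_of_eq (fun w => shape k w fun _ => .leaf) (fun _ _ h => h.shape_eq hk _)
      fun _ _ => eq_of_shape_eq hk⟩

theorem conGen_iff_polygonPartition {k : ℕ} (hk : 2 ≤ k) {u v : FreeMonoid ℕ} :
    conGen (ThompsonRel k) u v ↔
      polygonPartition (starSequence k u) = polygonPartition (starSequence k v) :=
  ⟨eq_of_conGen (wordPartition k) fun _ _ h => h.wordPartition_eq hk,
    conGen_of_eq (wordPartition k) (fun _ _ h => h.wordPartition_eq hk) fun _ _ => eq_of_top hk⟩

/-- All words of the class rewrite upwards to the same top word, and each rewriting step is a step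
up. -/
theorem exists_greatest {k : ℕ} (hk : 2 ≤ k) (u : FreeMonoid ℕ) :
    ∃ t, TamariEquiv k t u ∧
      (∀ v, TamariEquiv k v u → WeakLE (starSequence k v) (starSequence k t)) ∧
      Avoids132 (starSequence k t) := by
  obtain ⟨t, hut, ht⟩ := exists_top k u.toList
  have htu := (conGen (ThompsonRel k)).symm (conGen_of_reflTransGen hut)
  refine ⟨FreeMonoid.ofList t, (conGen_iff_tamariEquiv hk).1 htu, fun v hv => ?_,
    avoids132_of_top ht⟩
  obtain ⟨s, hvs, hs⟩ := exists_top k v.toList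
  have hts := (conGen (ThompsonRel k)).trans htu ((conGen (ThompsonRel k)).trans
    ((conGen (ThompsonRel k)).symm ((conGen_iff_tamariEquiv hk).2 hv)) (conGen_of_reflTransGen hvs))
  obtain rfl : t = s := eq_of_top hk ht hs ((conGen_iff_polygonPartition hk).1 hts)
  exact weakLE_of_reflTransGen hk hvs

theorem exists_least {k : ℕ} (hk : 2 ≤ k) (u : FreeMonoid ℕ) :
    ∃ b, TamariEquiv k b u ∧
      (∀ v, TamariEquiv k v u → WeakLE (starSequence k b) (starSequence k v)) ∧
      Avoids231 (starSequence k b) := by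
  obtain ⟨b, hbu, hb⟩ := exists_bottom k u.toList
  have hbu := conGen_of_reflTransGen hbu
  refine ⟨FreeMonoid.ofList b, (conGen_iff_tamariEquiv hk).1 hbu, fun v hv => ?_,
    avoids231_of_bottom hb⟩
  obtain ⟨s, hsv, hs⟩ := exists_bottom k v.toList
  have hbs := (conGen (ThompsonRel k)).trans hbu ((conGen (ThompsonRel k)).symm
    ((conGen (ThompsonRel k)).trans (conGen_of_reflTransGen hsv)
      ((conGen_iff_tamariEquiv hk).2 hv)))
  obtain rfl : b = s := eq_of_bottom hk hb hs ((conGen_iff_polygonPartition hk).1 hbs)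
  exact weakLE_of_reflTransGen hk hsv

end PolygonTamari

theorem mainTheorem9 (k : ℕ) (hk : 2 ≤ k) :
    -- words correspond to linearized forests and to star sequences
    Set.BijOn (PolygonTamari.linearizedForest k) Set.univ
      {f | PolygonTamari.IsLinearizedForest k f} ∧
    Set.BijOn (PolygonTamari.starSequence k) Set.univ
      {σ | PolygonTamari.IsStarSequence k σ} ∧
    -- words give exactly the partitions of polygons, and these define the same equivalence
    Set.range (fun u => PolygonTamari.polygonPartition (PolygonTamari.starSequence k u)) =
      {E | PolygonTamari.IsPolygonPartition k E} ∧
    (∀ u v : FreeMonoid ℕ, PolygonTamari.TamariEquiv k u v ↔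
      PolygonTamari.polygonPartition (PolygonTamari.starSequence k u) =
        PolygonTamari.polygonPartition (PolygonTamari.starSequence k v)) ∧
    -- the equivalence is a monoid congruence and the quotient is the Thompson monoid
    (∃ c : Con (FreeMonoid ℕ), (∀ u v, c u v ↔ PolygonTamari.TamariEquiv k u v) ∧
      ∃ φ : c.Quotient ≃* PolygonTamari.ThompsonMonoid k,
        ∀ i : ℕ, φ ((FreeMonoid.of i : FreeMonoid ℕ) : c.Quotient) =
          PresentedMonoid.of (PolygonTamari.ThompsonRel k) i) ∧
    -- every class has a top element and a bottom element
    (∀ u : FreeMonoid ℕ,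
      (∃ t, PolygonTamari.TamariEquiv k t u ∧
        (∀ v, PolygonTamari.TamariEquiv k v u →
          PolygonTamari.WeakLE (PolygonTamari.starSequence k v)
            (PolygonTamari.starSequence k t)) ∧
        PolygonTamari.Avoids132 (PolygonTamari.starSequence k t)) ∧
      (∃ b, PolygonTamari.TamariEquiv k b u ∧
        (∀ v, PolygonTamari.TamariEquiv k v u →
          PolygonTamari.WeakLE (PolygonTamari.starSequence k b)
            (PolygonTamari.starSequence k v)) ∧
        PolygonTamari.Avoids231 (PolygonTamari.starSequence k b))) := by
  exact ⟨PolygonTamari.bijOn_linearizedForest hk, PolygonTamari.bijOn_starSequence hk,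
    PolygonTamari.range_polygonPartition hk,
    fun _ _ => (PolygonTamari.conGen_iff_tamariEquiv hk).symm.trans
      (PolygonTamari.conGen_iff_polygonPartition hk),
    ⟨conGen (PolygonTamari.ThompsonRel k), fun _ _ => PolygonTamari.conGen_iff_tamariEquiv hk,
      -- A presented monoid is by definition the quotient by `conGen` of its relations, so the
      -- isomorphism is the identity.
      MulEquiv.refl _, fun _ => rfl⟩,
    fun u => ⟨PolygonTamari.exists_greatest hk u, PolygonTamari.exists_least hk u⟩⟩
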